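/- Fix $\rho>0$. For $n\ge 1$ let $T_n^\rho:[n]\to[n]$ be the random mapping with preferential attachment defined by the following urn scheme. There are $n$ urns, with initial weights $a_1(1)=\dots=a_n(1)=\rho$. For $k=1,\dots,n$ in turn, given the choices made in the rounds $1,\dots,k-1$ and the resulting weights $a_1(k),\dots,a_n(k)$, set $T_n^\rho(k)=j$ with probability $a_j(k)/\sum_{i=1}^n a_i(k)$; if $T_n^\rho(k)=j$, put $a_j(k+1)=a_j(k)+1$ and $a_i(k+1)=a_i(k)$ for $i\neq j$. Let $G_n^\rho$ be the directed graph on the vertex set $[n]$ with an edge from $i$ to $T_n^\rho(i)$ for every $i$, and let $L_1(n)\ge L_2(n)\ge\cdots$ be the sizes (numbers of vertices) of its connected components in non-increasing order, padded by zeros. Then, as $n\to\infty$, the joint distribution of the normalized order statistics $\left(\frac{L_1(n)}{n},\frac{L_2(n)}{n},\dots\right)$ converges weakly to the Poisson–Dirichlet$(1/2)$ distribution on the simplex $\nabla=\{(x_i)_{i\ge1}:\sum_i x_i\le 1,\ x_i\ge x_{i+1}\ge 0\text{ for every } i\ge 1\}$ with the topology of coordinatewise convergence. Here Poisson–Dirichlet$(\theta)$,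 $\theta>0$, is the distribution of the non-increasing rearrangement of the sequence $Z_k\prod_{i<k}(1-Z_i)$, $k\ge1$, where $Z_1,Z_2,\dots$ are independent random variables on $(0,1)$ with density $\theta(1-x)^{\theta-1}$; for $\theta=1/2$ this density is $\frac{1}{2\sqrt{1-x}}$. -/

import Mathlib

open MeasureTheory ProbabilityTheory Filter Topology

noncomputable section

/-! ### The random mapping with preferential attachment -/

/-- The weights of the `n` urns after the first `k` rounds of the urn scheme have produced the
choices `x 0, …, x (k - 1)`: all weights are `ρ` at the start, and in each round the weight of the
chosen urn increases by one. -/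
def urnWeight {n : ℕ} (ρ : ℝ) : (k : ℕ) → (Fin k → Fin n) → Fin n → ℝ
  | 0, _ => fun _ => ρ
  | k + 1, x =>
      Function.update (urnWeight ρ k (Fin.init x)) (x (Fin.last k))
        (urnWeight ρ k (Fin.init x) (x (Fin.last k)) + 1)

theorem urnWeight_pos {n : ℕ} {ρ : ℝ} (hρ : 0 < ρ) :
    ∀ (k : ℕ) (x : Fin k → Fin n) (j : Fin n), 0 < urnWeight ρ k x j
  | 0, _, _ => hρ
  | k + 1, x, j => by
      have h := urnWeight_pos hρ k (Fin.init x)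
      unfold urnWeight
      by_cases hj : j = x (Fin.last k)
      · subst hj
        rw [Function.update_self]
        linarith [h (x (Fin.last k))]
      · rw [Function.update_of_ne hj]
        exact h j

/-- The distribution of the next choice, given the earlier choices `x`: urn `j` is chosen with
probability `a j / ∑ i, a i`, where `a` is the current weight vector. -/
def urnChoice {n : ℕ} [NeZero n] {ρ : ℝ} (hρ : 0 < ρ) {k : ℕ} (x : Fin k → Fin n) :
    PMF (Fin n) :=
  PMF.normalize (fun j => ENNReal.ofReal (urnWeight ρ k x j))
    (by
      rw [Ne, ENNReal.tsum_eq_zero]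
      intro h
      have h0 := ENNReal.ofReal_eq_zero.1 (h 0)
      exact absurd (urnWeight_pos hρ k x 0) (not_lt.2 h0))
    (by
      rw [tsum_fintype]
      exact ENNReal.sum_ne_top.2 fun _ _ => ENNReal.ofReal_ne_top)

/-- The joint distribution of the choices made in the first `k` rounds of the urn scheme with `n`
urns. -/
def urnHistory (n : ℕ) [NeZero n] {ρ : ℝ} (hρ : 0 < ρ) : (k : ℕ) → PMF (Fin k → Fin n)
  | 0 => PMF.pure Fin.elim0
  | k + 1 => (urnHistory n hρ k).bind fun x =>
      (urnChoice hρ x).map fun j => (Fin.snoc x j : Fin (k + 1) → Fin n)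

/-- The distribution of the random mapping with preferential attachment, with parameter `ρ`, on
`n` points: the image of the `k`-th point is the choice made in the `k`-th round. -/
def preferentialMapping (n : ℕ) [NeZero n] {ρ : ℝ} (hρ : 0 < ρ) : PMF (Fin n → Fin n) :=
  urnHistory n hρ n

/-! ### The ranked simplex and ranking -/

/-- The simplex `∇` of non-increasing non-negative sequences with sum at most one, with the
topology of coordinatewise convergence. -/
def rankedSimplex : Set (ℕ → ℝ) :=
  {x | (∀ i, 0 ≤ x i) ∧ (∀ i, x (i + 1) ≤ x i) ∧ Summable x ∧ ∑' i, x i ≤ 1}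

/-- The `k`-th largest term (`k = 0, 1, …`, with multiplicity) of a non-negative family: the
supremum, over all sets of `k + 1` indices, of the smallest term on the set. If there are fewer
than `k + 1` indices, this is `0` (a finite family is padded by zeros). -/
def ranked {ι : Type*} (x : ι → ℝ) (k : ℕ) : ℝ :=
  ⨆ s : {s : Finset ι // s.card = k + 1},
    s.1.inf' (Finset.card_pos.1 (by rw [s.2]; exact Nat.succ_pos k)) x

theorem ranked_mem {ι : Type*} {x : ι → ℝ} (h0 : ∀ i, 0 ≤ x i)
    (h1 : ∀ s : Finset ι, ∑ i ∈ s, x i ≤ 1) : ranked x ∈ rankedSimplex := by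
  classical
  have hle : ∀ i, x i ≤ 1 := fun i => by simpa using h1 {i}
  have hbdd : ∀ k, BddAbove (Set.range fun s : {s : Finset ι // s.card = k + 1} =>
      s.1.inf' (Finset.card_pos.1 (by rw [s.2]; exact Nat.succ_pos k)) x) := by
    intro k
    refine ⟨1, ?_⟩
    rintro _ ⟨s, rfl⟩
    obtain ⟨i, hi⟩ := Finset.card_pos.1 (show 0 < s.1.card by rw [s.2]; exact Nat.succ_pos k)
    exact (Finset.inf'_le _ hi).trans (hle i)
  have hnn : ∀ k, 0 ≤ ranked x k := fun k =>
    Real.iSup_nonneg fun s => Finset.le_inf' _ _ fun i _ => h0 i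
  have hanti : ∀ k, ranked x (k + 1) ≤ ranked x k := by
    intro k
    refine Real.iSup_le (fun s => ?_) (hnn k)
    obtain ⟨t, hts, htc⟩ := Finset.exists_subset_card_eq (show k + 1 ≤ s.1.card by rw [s.2]; omega)
    refine le_trans ?_ (le_ciSup (hbdd k) ⟨t, htc⟩)
    exact Finset.inf'_mono _ hts _
  -- greedily chosen distinct indices whose terms nearly attain the first `m` ranked values
  have hgreedy : ∀ ε : ℝ, 0 < ε → ∀ m : ℕ, ∃ t : Finset ι, t.card ≤ m ∧
      ∑ k ∈ Finset.range m, ranked x k ≤ ∑ i ∈ t, x i + m * ε := by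
    intro ε hε m
    induction m with
    | zero => exact ⟨∅, by simp, by simp⟩
    | succ m ih =>
      obtain ⟨t, htc, hts⟩ := ih
      by_cases hne : Nonempty {s : Finset ι // s.card = m + 1}
      · obtain ⟨s, hs⟩ := exists_lt_of_lt_ciSup (show ranked x m - ε < ranked x m by linarith)
        obtain ⟨i, his, hit⟩ := Finset.exists_mem_notMem_of_card_lt_card
          (show t.card < s.1.card by rw [s.2]; omega)
        refine ⟨insert i t, (Finset.card_insert_le _ _).trans (by omega), ?_⟩
        have h2 := hs.trans_le (Finset.inf'_le x his)
        rw [Finset.sum_range_succ, Finset.sum_insert hit]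
        push_cast
        linarith
      · have hz : ranked x m = 0 := by
          have := not_nonempty_iff.1 hne
          exact Real.iSup_of_isEmpty _
        refine ⟨t, by omega, ?_⟩
        rw [Finset.sum_range_succ, hz]
        push_cast
        linarith
  have hsum : ∀ m : ℕ, ∑ k ∈ Finset.range m, ranked x k ≤ 1 := by
    intro m
    refine le_of_forall_pos_le_add fun δ hδ => ?_
    have hm : (0 : ℝ) < m + 1 := by positivity
    obtain ⟨t, -, ht⟩ := hgreedy (δ / (m + 1)) (by positivity) m
    have : (m : ℝ) * (δ / (m + 1)) ≤ δ := by
      rw [mul_div_assoc', div_le_iff₀ hm]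
      nlinarith
    linarith [h1 t]
  exact ⟨hnn, hanti, summable_of_sum_range_le hnn hsum, Real.tsum_le_of_sum_range_le hnn hsum⟩

theorem measurable_ranked {ι : Type*} [Countable ι] :
    Measurable (ranked : (ι → ℝ) → ℕ → ℝ) := by
  refine measurable_pi_lambda _ fun k => ?_
  refine Measurable.iSup fun s => ?_
  have h : ∀ (t : Finset ι) (ht : t.Nonempty), Measurable fun x : ι → ℝ => t.inf' ht x := by
    intro t ht
    induction ht using Finset.Nonempty.cons_induction with
    | singleton a => simpa using measurable_pi_apply a
    | cons a t ha ht ih =>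
      simp only [Finset.inf'_cons ht]
      exact (measurable_pi_apply a).min ih
  exact h _ _

/-! ### Component sizes -/

/-- The directed graph `G(f)` of a mapping `f`: there is an edge from `i` to `j` iff `f i = j`. -/
def mappingDigraph {V : Type*} (f : V → V) : Digraph V where
  Adj i j := f i = j

/-- The connected components of `G(f)` (edge directions are ignored). -/
abbrev MappingComponent {V : Type*} (f : V → V) : Type _ :=
  (mappingDigraph f).toSimpleGraphInclusive.ConnectedComponent

/-- The normalized size of a component: its number of vertices divided by `n`. -/
def normalizedSize {n : ℕ} (f : Fin n → Fin n) (c : MappingComponent f) : ℝ :=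
  (c.supp.ncard : ℝ) / n

theorem sum_normalizedSize_le {n : ℕ} (f : Fin n → Fin n) (s : Finset (MappingComponent f)) :
    ∑ c ∈ s, normalizedSize f c ≤ 1 := by
  classical
  unfold normalizedSize
  rw [← Finset.sum_div]
  refine div_le_one_of_le₀ ?_ (Nat.cast_nonneg n)
  have h : ∑ c ∈ s, c.supp.ncard ≤ n := by
    have h1 : ∀ c ∈ s, c.supp.ncard = (Finset.univ.filter fun v : Fin n =>
        (mappingDigraph f).toSimpleGraphInclusive.connectedComponentMk v = c).card := by
      intro c _
      rw [← Set.ncard_coe_finset]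
      congr 1
      ext v
      simp
    rw [Finset.sum_congr rfl h1, ← Finset.card_biUnion]
    · exact (Finset.card_le_univ _).trans (by simp)
    · intro a _ b _ hab
      refine Finset.disjoint_left.2 fun v hv hv' => hab ?_
      simp only [Finset.mem_filter, Finset.mem_univ, true_and] at hv hv'
      rw [← hv, ← hv']
  exact_mod_cast h

/-- The normalized order statistics of the component sizes of `G(f)`: the component sizes divided
by `n`, in non-increasing order and padded by zeros. -/
def orderStatistics {n : ℕ} (f : Fin n → Fin n) : rankedSimplex :=
  ⟨ranked (normalizedSize f), ranked_mem (fun _ => by unfold normalizedSize; positivity)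
    (sum_normalizedSize_le f)⟩

/-- The joint distribution of the normalized order statistics of the component sizes for the
random mapping with preferential attachment. -/
def orderStatisticsLaw (n : ℕ) [NeZero n] {ρ : ℝ} (hρ : 0 < ρ) :
    ProbabilityMeasure rankedSimplex :=
  ⟨(preferentialMapping n hρ).toMeasure.map orderStatistics,
    Measure.isProbabilityMeasure_map (Measurable.of_discrete.aemeasurable)⟩

/-! ### The Poisson–Dirichlet distribution -/

/-- Stick-breaking: the `k`-th piece is the fraction `z k` of what the earlier pieces leave of a
stick of length one. -/
def stick (z : ℕ → unitInterval) (k : ℕ) : ℝ :=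
  (z k : ℝ) * ∏ i ∈ Finset.range k, (1 - (z i : ℝ))

theorem stick_nonneg (z : ℕ → unitInterval) (k : ℕ) : 0 ≤ stick z k :=
  mul_nonneg (z k).2.1 (Finset.prod_nonneg fun i _ => sub_nonneg.2 (z i).2.2)

theorem sum_stick_le (z : ℕ → unitInterval) (s : Finset ℕ) : ∑ k ∈ s, stick z k ≤ 1 := by
  have h : ∀ m, ∑ k ∈ Finset.range m, stick z k = 1 - ∏ i ∈ Finset.range m, (1 - (z i : ℝ)) := by
    intro m
    induction m with
    | zero => simp
    | succ m ih =>
      rw [Finset.sum_range_succ, ih, Finset.prod_range_succ, stick]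
      ring
  obtain ⟨m, hm⟩ := Finset.exists_nat_subset_range s
  refine (Finset.sum_le_sum_of_subset_of_nonneg hm fun k _ _ => stick_nonneg z k).trans ?_
  rw [h m]
  have : 0 ≤ ∏ i ∈ Finset.range m, (1 - (z i : ℝ)) :=
    Finset.prod_nonneg fun i _ => sub_nonneg.2 (z i).2.2
  linarith

/-- The pieces of the broken stick in non-increasing order. -/
def rankedSticks (z : ℕ → unitInterval) : rankedSimplex :=
  ⟨ranked (stick z), ranked_mem (stick_nonneg z) (sum_stick_le z)⟩

theorem measurable_rankedSticks : Measurable rankedSticks := by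
  refine Measurable.subtype_mk (measurable_ranked.comp ?_)
  refine measurable_pi_lambda _ fun k => ?_
  unfold stick
  fun_prop

/-- The Beta`(1, θ)` distribution, with density `θ (1 - x) ^ (θ - 1)`, on the unit interval. -/
def stickFraction (θ : ℝ) : Measure unitInterval :=
  (betaMeasure 1 θ).comap Subtype.val

theorem isProbabilityMeasure_stickFraction {θ : ℝ} (hθ : 0 < θ) :
    IsProbabilityMeasure (stickFraction θ) := by
  have : IsProbabilityMeasure (betaMeasure 1 θ) := isProbabilityMeasureBeta one_pos hθ
  constructor
  rw [stickFraction, comap_subtype_coe_apply measurableSet_Icc, Set.image_univ,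
    Subtype.range_coe, ← prob_compl_eq_zero_iff measurableSet_Icc, betaMeasure,
    withDensity_apply _ measurableSet_Icc.compl]
  refine setLIntegral_eq_zero measurableSet_Icc.compl fun x hx => ?_
  by_cases h : 0 ≤ x
  · exact betaPDF_eq_zero_of_one_le (le_of_not_ge fun h' => hx ⟨h, h'⟩)
  · exact betaPDF_eq_zero_of_nonpos (le_of_not_ge h)

/-- The Poisson–Dirichlet distribution with parameter `θ` on the simplex `∇`: the joint
distribution of the ranked pieces of a stick broken with independent Beta`(1, θ)` fractions. -/
def poissonDirichlet {θ : ℝ} (hθ : 0 < θ) : ProbabilityMeasure rankedSimplex :=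
  have := isProbabilityMeasure_stickFraction hθ
  ⟨(Measure.infinitePi fun _ : ℕ => stickFraction θ).map rankedSticks,
    Measure.isProbabilityMeasure_map measurable_rankedSticks.aemeasurable⟩

end

/-!
The proof is by the method of moments on the compact simplex `∇`. The power sums
`∑ i, x i ^ m` with `m ≥ 2` are continuous on `∇` and separate its points, so by the
Stone–Weierstrass theorem weak convergence follows from the convergence of the expectations of
polynomials in them (`tendsto_of_tendsto_integral_mono`). These
polynomials are spanned by the monomial symmetric functions `∑ x i₁ ^ l₁ * ⋯ * x iₖ ^ lₖ`, summed
over tuples of distinct indices; `mono` expresses them through power sums. Ranking a family does not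
change its power sums (`tsum_ranked_pow`), so that it can be ignored on both sides.

For the mapping, the probability of `f : [n] → [n]` is proportional to
`∏ j, ρ (ρ + 1) ⋯ (ρ + d j - 1)`, where `d j` are the in-degrees (`urnHistory_apply`). This weight
is multiplicative over unions of components. Hence, with exponential generating functions, pointing
at a component of size `k` with the factor `k ^ m` multiplies the generating function by the series
`K m = ∑ c k * k ^ m * x ^ k` of connected mappings (`totalWeightSeries_sum_erase`), and the total
for the exponents `l₁, …, lₖ` is `F * K l₁ * ⋯ * K lₖ`. Here `F` is the generating function of all
mappings, whose coefficients are `nρ (nρ + 1) ⋯ (nρ + n - 1) / n!`, and `K (m + 1)` is obtained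
from `K m` by the operator `θ = x d/dx`. Convolution identities of Rothe–Hagen type give the
differential equation `ρ θ F = F (F - 1) ((ρ + 1) F - 1)` (`eulerOp_weightSeries`). Therefore
`K 1 = θ F / F`, and with it every total, is a polynomial in `F`; the total for exponents with sum
`M` has degree `2 M + 1`.

Asymptotically only the leading term counts. By Stirling's formula, up to constants, the
coefficients of `F` are of the order `α ^ n / √n`. The differential equation, read as a recursion
between the coefficients of `F ^ a`, `F ^ (a + 1)` and `F ^ (a + 2)`, then determines the limits of
`[x ^ n] F ^ (2 M + 1) / (n ^ M * [x ^ n] F)` exactly and shows that lower powers are negligible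
(`tendsto_coeff_aeval_weightSeries`). The limit of the moments is `pdMoment (1 / 2) l`.

For the Poisson–Dirichlet distribution, the part of the stick that is left by the first break is a
rescaled independent copy of the whole stick. This gives a recursion for the moments, whose
solution is `pdMoment θ l` (`integral_mono_stick`).
-/

/-! ### Monomial symmetric functions in terms of power sums -/

/-- The lists obtained from `l` by adding `m` to one of its entries, one list for each position. -/
def bumps (m : ℕ) : List ℕ → List (List ℕ)
  | [] => []
  | a :: l => ((a + m) :: l) :: (bumps m l).map (a :: ·)

/-- The pairs consisting of an entry of `l` and the list of the other entries, one pair for each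
position. -/
def picks : List ℕ → List (ℕ × List ℕ)
  | [] => []
  | a :: l => (a, l) :: (picks l).map fun q => (q.1, a :: q.2)

theorem length_of_mem_bumps {m : ℕ} : ∀ {l l' : List ℕ}, l' ∈ bumps m l → l'.length = l.length
  | a :: l, l', h => by
    simp only [bumps, List.mem_cons, List.mem_map] at h
    rcases h with rfl | ⟨b, hb, rfl⟩
    · rfl
    · simp [length_of_mem_bumps hb]

theorem sum_of_mem_bumps {m : ℕ} : ∀ {l l' : List ℕ}, l' ∈ bumps m l → l'.sum = m + l.sum
  | a :: l, l', h => by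
    simp only [bumps, List.mem_cons, List.mem_map] at h
    rcases h with rfl | ⟨b, hb, rfl⟩
    · simp; ring
    · simp [sum_of_mem_bumps hb]; ring

theorem le_of_mem_bumps {r m : ℕ} : ∀ {l l' : List ℕ}, (∀ a ∈ l, r ≤ a) → l' ∈ bumps m l →
    ∀ a ∈ l', r ≤ a
  | a :: l, l', hl, h => by
    simp only [bumps, List.mem_cons, List.mem_map] at h
    simp only [List.mem_cons, forall_eq_or_imp] at hl
    rcases h with rfl | ⟨b, hb, rfl⟩
    · simp only [List.mem_cons, forall_eq_or_imp]
      exact ⟨by omega, hl.2⟩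
    · simp only [List.mem_cons, forall_eq_or_imp]
      exact ⟨hl.1, le_of_mem_bumps hl.2 hb⟩

theorem length_of_mem_picks : ∀ {l : List ℕ} {q : ℕ × List ℕ}, q ∈ picks l →
    q.2.length + 1 = l.length
  | a :: l, q, h => by
    simp only [picks, List.mem_cons, List.mem_map] at h
    rcases h with rfl | ⟨b, hb, rfl⟩
    · rfl
    · simp [length_of_mem_picks hb]

theorem perm_of_mem_picks : ∀ {l : List ℕ} {q : ℕ × List ℕ}, q ∈ picks l → (q.1 :: q.2).Perm l
  | a :: l, q, h => by
    simp only [picks, List.mem_cons, List.mem_map] at h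
    rcases h with rfl | ⟨b, hb, rfl⟩
    · rfl
    · exact (List.Perm.swap _ _ _).trans ((perm_of_mem_picks hb).cons a)

theorem map_fst_picks : ∀ l : List ℕ, (picks l).map Prod.fst = l
  | [] => rfl
  | a :: l => by
    rw [picks, List.map_cons, List.map_map]
    exact congrArg (a :: ·) (map_fst_picks l)

/-- Picking an entry of a bumped list: either the bumped entry, or one of the others. -/
theorem sum_bumps_picks {R : Type*} [CommRing R] (m : ℕ) : ∀ (l : List ℕ) (G : ℕ → List ℕ → R),
    ((bumps m l).map fun l' => ((picks l').map fun q => G q.1 q.2).sum).sum =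
      ((picks l).map fun q => G (q.1 + m) q.2 + ((bumps m q.2).map fun l' => G q.1 l').sum).sum
  | [], G => by simp [bumps, picks]
  | a :: l, G => by
    have ih := sum_bumps_picks m l fun b l' => G b (a :: l')
    simp only [bumps, picks, List.map_cons, List.sum_cons, List.map_map, Function.comp_def,
      List.sum_map_add] at ih ⊢
    linear_combination ih

/-- The monomial symmetric function with exponents `l`, that is, the sum of
`x i₁ ^ l₁ * ⋯ * x iₖ ^ lₖ` over all tuples of distinct indices `i₁, …, iₖ`, as a polynomial in the
power sums `p m = ∑ i, x i ^ m`: multiplying the monomial function of `l` by `p m` adds either a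
new index, which gives the exponents `m :: l`, or an index that is already in the tuple. -/
def mono {R : Type*} [CommRing R] (p : ℕ → R) : List ℕ → R
  | [] => 1
  | m :: l => p m * mono p l - ((bumps m l).attach.map fun l' => mono p l'.1).sum
termination_by l => l.length
decreasing_by
  · simp
  · have := length_of_mem_bumps l'.2
    simp [this]

section mono

variable {R : Type*} [CommRing R]

theorem mono_nil (p : ℕ → R) : mono p [] = 1 := by rw [mono]

theorem mono_cons (p : ℕ → R) (m : ℕ) (l : List ℕ) :
    mono p (m :: l) = p m * mono p l - ((bumps m l).map fun l' => mono p l').sum := by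
  rw [mono, List.attach_map_val (f := fun l' => mono p l')]

theorem mono_induction {P : List ℕ → Prop} (nil : P [])
    (cons : ∀ m l, (∀ l' : List ℕ, l'.length ≤ l.length → P l') → P (m :: l)) (l : List ℕ) :
    P l := by
  suffices h : ∀ n, ∀ l : List ℕ, l.length ≤ n → P l from h _ l le_rfl
  intro n
  induction n with
  | zero => intro l hl; rw [List.length_eq_zero_iff.1 (by omega : l.length = 0)]; exact nil
  | succ n ih =>
    rintro (_ | ⟨m, l⟩) hl
    · exact nil
    · exact cons m l fun l' hl' => ih l' (by simp at hl; omega)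

/-- Monomial symmetric functions of a family to which the term `z` is added: the new term either
does not occur, or takes one of the exponents. -/
theorem mono_add_pow (p : ℕ → R) (z : R) (l : List ℕ) :
    mono (fun m => p m + z ^ m) l =
      mono p l + ((picks l).map fun q => z ^ q.1 * mono p q.2).sum := by
  induction l using mono_induction with
  | nil => simp [mono_nil, picks]
  | cons m l ih =>
    have h1 : ((bumps m l).map fun l' => mono (fun m => p m + z ^ m) l').sum =
        ((bumps m l).map fun l' => mono p l' +
          ((picks l').map fun q => z ^ q.1 * mono p q.2).sum).sum :=
      congrArg List.sum (List.map_congr_left fun l' hl' => ih l' (length_of_mem_bumps hl').le)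
    have h2 : ((picks l).map fun q => z ^ q.1 * mono p (m :: q.2)).sum =
        p m * ((picks l).map fun q => z ^ q.1 * mono p q.2).sum -
          ((picks l).map fun q => ((bumps m q.2).map fun l' => z ^ q.1 * mono p l').sum).sum := by
      rw [← List.sum_map_mul_left, eq_sub_iff_add_eq, ← List.sum_map_add]
      refine congrArg List.sum (List.map_congr_left fun q _ => ?_)
      rw [mono_cons, mul_sub, List.sum_map_mul_left]
      ring
    have h3 : ((picks l).map fun q => z ^ (q.1 + m) * mono p q.2).sum =
        z ^ m * ((picks l).map fun q => z ^ q.1 * mono p q.2).sum := by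
      rw [← List.sum_map_mul_left]
      refine congrArg List.sum (List.map_congr_left fun q _ => ?_)
      ring
    rw [mono_cons, h1, ih l le_rfl, List.sum_map_add,
      sum_bumps_picks m l fun a l' => z ^ a * mono p l', List.sum_map_add, h3, mono_cons, picks,
      List.map_cons, List.sum_cons, List.map_map]
    simp only [Function.comp_def]
    rw [h2]
    ring

theorem mono_pow_mul (p : ℕ → R) (c : R) (l : List ℕ) :
    mono (fun m => c ^ m * p m) l = c ^ l.sum * mono p l := by
  induction l using mono_induction with
  | nil => simp [mono_nil]
  | cons m l ih =>
    have h1 : ((bumps m l).map fun l' => mono (fun m => c ^ m * p m) l').sum =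
        c ^ (m + l.sum) * ((bumps m l).map fun l' => mono p l').sum := by
      rw [← List.sum_map_mul_left]
      refine congrArg List.sum (List.map_congr_left fun l' hl' => ?_)
      rw [ih l' (length_of_mem_bumps hl').le, sum_of_mem_bumps hl']
    rw [mono_cons, mono_cons, h1, ih l le_rfl, List.sum_cons, pow_add]
    ring

/-- The value of `mono` only depends on the power sums with large exponents if all entries of the
list are large. -/
theorem mono_congr {r : ℕ} {p p' : ℕ → R} (h : ∀ m, r ≤ m → p m = p' m) (l : List ℕ)
    (hl : ∀ m ∈ l, r ≤ m) : mono p l = mono p' l := by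
  induction l using mono_induction with
  | nil => simp [mono_nil]
  | cons m l ih =>
    simp only [List.mem_cons, forall_eq_or_imp] at hl
    rw [mono_cons, mono_cons, h m hl.1, ih l le_rfl hl.2]
    congr 2
    exact List.map_congr_left fun l' hl' =>
      ih l' (length_of_mem_bumps hl').le (le_of_mem_bumps hl.2 hl')

theorem mono_zero {l : List ℕ} (hl : l ≠ []) : mono (fun _ => (0 : R)) l = 0 := by
  induction l using mono_induction with
  | nil => exact absurd rfl hl
  | cons m l ih =>
    rw [mono_cons, zero_mul, zero_sub, neg_eq_zero]
    refine List.sum_eq_zero fun a ha => ?_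
    obtain ⟨l', hl', rfl⟩ := List.mem_map.1 ha
    refine ih l' (length_of_mem_bumps hl').le ?_
    rintro rfl
    have := length_of_mem_bumps hl'
    rw [List.length_nil, eq_comm, List.length_eq_zero_iff] at this
    subst this
    simp [bumps] at hl'

/-- The power sums of a multiset of natural numbers. -/
def powerSum (R : Type*) [CommRing R] (s : Multiset ℕ) (m : ℕ) : R :=
  (s.map fun a : ℕ => (a : R) ^ m).sum

theorem powerSum_cons (a : ℕ) (s : Multiset ℕ) :
    powerSum R (a ::ₘ s) = fun m => powerSum R s m + (a : R) ^ m := by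
  funext m
  simp [powerSum, add_comm]

/-- Summing over the index that takes the first exponent. -/
theorem sum_pow_mul_mono_erase (m : ℕ) (s : Multiset ℕ) : ∀ l : List ℕ,
    (s.map fun a : ℕ => (a : R) ^ m * mono (powerSum R (s.erase a)) l).sum =
      mono (powerSum R s) (m :: l) := by
  induction s using Multiset.induction with
  | empty =>
    intro l
    have : powerSum R (0 : Multiset ℕ) = fun _ => 0 := by funext m; simp [powerSum]
    rw [this, mono_zero (by simp)]
    simp
  | cons b s ih =>
    intro l
    have h1 : (s.map fun a : ℕ => (a : R) ^ m * mono (powerSum R ((b ::ₘ s).erase a)) l).sum =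
        (s.map fun a : ℕ => (a : R) ^ m * mono (powerSum R (s.erase a)) l +
          ((picks l).map fun q => (b : R) ^ q.1 *
            ((a : R) ^ m * mono (powerSum R (s.erase a)) q.2)).sum).sum := by
      refine congrArg Multiset.sum (Multiset.map_congr rfl fun a ha => ?_)
      have : (b ::ₘ s).erase a = b ::ₘ s.erase a := by
        by_cases hab : b = a
        · subst hab
          rw [Multiset.erase_cons_head, Multiset.cons_erase ha]
        · rw [Multiset.erase_cons_tail _ hab]
      rw [this, powerSum_cons, mono_add_pow, mul_add, ← List.sum_map_mul_left]
      congr 2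
      refine List.map_congr_left fun q _ => ?_
      ring
    have h2 : (s.map fun a : ℕ => ((picks l).map fun q => (b : R) ^ q.1 *
            ((a : R) ^ m * mono (powerSum R (s.erase a)) q.2)).sum).sum =
        ((picks l).map fun q => (b : R) ^ q.1 * mono (powerSum R s) (m :: q.2)).sum := by
      generalize picks l = L
      induction L with
      | nil => simp
      | cons q L ihL =>
        simp only [List.map_cons, List.sum_cons, Multiset.sum_map_add, ihL]
        rw [Multiset.sum_map_mul_left, ih]
    rw [Multiset.map_cons, Multiset.sum_cons, h1, Multiset.sum_map_add, ih, h2,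
      Multiset.erase_cons_head, powerSum_cons, mono_add_pow, picks]
    simp only [List.map_cons, List.sum_cons, List.map_map, Function.comp_def]
    ring

end mono

/-! ### The generating function of the total weights -/

open Polynomial in
/-- The polynomial `r ↦ r / (t n + r) * ((t n + r) choose n)` with `t = 1 + ρ`. -/
noncomputable def rothePoly (ρ : ℝ) : ℕ → ℝ[X]
  | 0 => 1
  | n + 1 => C ((n + 1).factorial : ℝ)⁻¹ * X * (ascPochhammer ℝ n).comp (X + C (ρ * (n + 1) + 1))

open Polynomial in
/-- The polynomial `s ↦ (t n + s) choose n` with `t = 1 + ρ`. -/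
noncomputable def shiftedChoosePoly (ρ : ℝ) (n : ℕ) : ℝ[X] :=
  C (n.factorial : ℝ)⁻¹ * (ascPochhammer ℝ n).comp (X + C (ρ * n + 1))

theorem eval_rothePoly_succ (ρ r : ℝ) (n : ℕ) : (rothePoly ρ (n + 1)).eval r =
    r * (ascPochhammer ℝ n).eval (r + ρ * (n + 1) + 1) / (n + 1).factorial := by
  simp [rothePoly, add_assoc]
  ring

theorem eval_shiftedChoosePoly (ρ s : ℝ) (n : ℕ) : (shiftedChoosePoly ρ n).eval s =
    (ascPochhammer ℝ n).eval (s + ρ * n + 1) / n.factorial := by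
  simp [shiftedChoosePoly, add_assoc]
  ring

theorem eval_ascPochhammer_succ_left (n : ℕ) (y : ℝ) :
    (ascPochhammer ℝ (n + 1)).eval y = y * (ascPochhammer ℝ n).eval (y + 1) := by
  simp [ascPochhammer_succ_left]

theorem rothePoly_sub (ρ r : ℝ) (n : ℕ) :
    (rothePoly ρ (n + 1)).eval r - (rothePoly ρ (n + 1)).eval (r - 1) =
      (rothePoly ρ n).eval (r + ρ) := by
  cases n with
  | zero => rw [eval_rothePoly_succ, eval_rothePoly_succ]; simp [rothePoly]
  | succ n =>
    have h1 := ascPochhammer_succ_eval n (r + ρ * ((n + 1 : ℕ) + 1) + 1)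
    have h2 := eval_ascPochhammer_succ_left n (r - 1 + ρ * ((n + 1 : ℕ) + 1) + 1)
    rw [show r - 1 + ρ * ((n + 1 : ℕ) + 1) + 1 + 1 = r + ρ * ((n + 1 : ℕ) + 1) + 1 by ring] at h2
    rw [eval_rothePoly_succ, eval_rothePoly_succ, h1, h2, eval_rothePoly_succ,
      show r + ρ + ρ * (n + 1) + 1 = r + ρ * ((n + 1 : ℕ) + 1) + 1 by push_cast; ring,
      Nat.factorial_succ (n + 1)]
    push_cast
    have : ((n + 1).factorial : ℝ) ≠ 0 := by positivity
    field_simp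
    ring

theorem shiftedChoosePoly_sub (ρ s : ℝ) (n : ℕ) :
    (shiftedChoosePoly ρ (n + 1)).eval s - (shiftedChoosePoly ρ (n + 1)).eval (s - 1) =
      (shiftedChoosePoly ρ n).eval (s + ρ) := by
  have h1 := ascPochhammer_succ_eval n (s + ρ * (n + 1 : ℕ) + 1)
  have h2 := eval_ascPochhammer_succ_left n (s - 1 + ρ * (n + 1 : ℕ) + 1)
  rw [show s - 1 + ρ * (n + 1 : ℕ) + 1 + 1 = s + ρ * (n + 1 : ℕ) + 1 by ring] at h2
  rw [eval_shiftedChoosePoly, eval_shiftedChoosePoly, h1, h2, eval_shiftedChoosePoly,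
    show s + ρ + ρ * n + 1 = s + ρ * (n + 1 : ℕ) + 1 by push_cast; ring, Nat.factorial_succ]
  push_cast
  have : (n.factorial : ℝ) ≠ 0 := by positivity
  field_simp
  ring

/-- Two polynomials are equal if they agree at `0` and have the same differences. -/
theorem Polynomial.eq_of_sub_eq {P Q : Polynomial ℝ} (h0 : P.eval 0 = Q.eval 0)
    (h : ∀ r, P.eval r - P.eval (r - 1) = Q.eval r - Q.eval (r - 1)) : P = Q := by
  have hn : ∀ n : ℕ, P.eval (n : ℝ) = Q.eval (n : ℝ) := by
    intro n
    induction n with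
    | zero => simpa using h0
    | succ n ih =>
      have := h (n + 1 : ℕ)
      rw [show ((n + 1 : ℕ) : ℝ) - 1 = n by push_cast; ring] at this
      linarith
  refine Polynomial.eq_of_infinite_eval_eq P Q ?_
  exact (Set.infinite_range_of_injective (Nat.cast_injective (R := ℝ))).mono
    (by rintro _ ⟨n, rfl⟩; exact hn n)

/-- The Rothe–Hagen convolution, for any family of polynomials with the same differences. -/
theorem rothe_convolution (ρ : ℝ) {D : ℕ → Polynomial ℝ} (h0 : D 0 = 1)
    (hD : ∀ n s, (D (n + 1)).eval s - (D (n + 1)).eval (s - 1) = (D n).eval (s + ρ))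
    (n : ℕ) : ∀ r s : ℝ, ∑ q ∈ Finset.HasAntidiagonal.antidiagonal n,
      (rothePoly ρ q.1).eval r * (D q.2).eval s = (D n).eval (r + s) := by
  induction n with
  | zero => intro r s; simp [rothePoly, h0]
  | succ n ih =>
    intro r s
    have key : ∑ q ∈ Finset.HasAntidiagonal.antidiagonal (n + 1),
        rothePoly ρ q.1 * Polynomial.C ((D q.2).eval s) =
          (D (n + 1)).comp (Polynomial.X + Polynomial.C s) := by
      refine Polynomial.eq_of_sub_eq ?_ fun r => ?_
      · rw [Finset.Nat.sum_antidiagonal_succ]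
        simp only [Polynomial.eval_add, Polynomial.eval_finsetSum, Polynomial.eval_mul,
          eval_rothePoly_succ]
        simp [rothePoly]
      · have hr : (D (n + 1)).eval (r + s) - (D (n + 1)).eval (r - 1 + s) =
            (D n).eval (r + ρ + s) := by
          have := hD n (r + s)
          rwa [show r + s - 1 = r - 1 + s by ring, show r + s + ρ = r + ρ + s by ring] at this
        simp only [Polynomial.eval_comp, Polynomial.eval_add, Polynomial.eval_X,
          Polynomial.eval_C]
        rw [hr, ← ih, Finset.Nat.sum_antidiagonal_succ]
        simp only [Polynomial.eval_add, Polynomial.eval_finsetSum, Polynomial.eval_mul,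
          Polynomial.eval_C]
        simp only [← rothePoly_sub, sub_mul, Finset.sum_sub_distrib]
        simp [rothePoly]
    have := congrArg (Polynomial.eval r) key
    simpa [Polynomial.eval_finsetSum] using this

/-- The generating function of `rothePoly ρ n` at `r`; it is the `r`-th power of the generalized
binomial series. -/
noncomputable def rotheSeries (ρ r : ℝ) : PowerSeries ℝ :=
  PowerSeries.mk fun n => (rothePoly ρ n).eval r

/-- The generating function of `shiftedChoosePoly ρ n` at `s`. -/
noncomputable def shiftedChooseSeries (ρ s : ℝ) : PowerSeries ℝ :=
  PowerSeries.mk fun n => (shiftedChoosePoly ρ n).eval s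

theorem coeff_rotheSeries (ρ r : ℝ) (n : ℕ) :
    PowerSeries.coeff n (rotheSeries ρ r) = (rothePoly ρ n).eval r :=
  PowerSeries.coeff_mk _ _

theorem coeff_shiftedChooseSeries (ρ s : ℝ) (n : ℕ) :
    PowerSeries.coeff n (shiftedChooseSeries ρ s) = (shiftedChoosePoly ρ n).eval s :=
  PowerSeries.coeff_mk _ _

theorem rotheSeries_mul (ρ r s : ℝ) :
    rotheSeries ρ r * rotheSeries ρ s = rotheSeries ρ (r + s) := by
  ext n
  simp only [rotheSeries, PowerSeries.coeff_mul, PowerSeries.coeff_mk]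
  exact rothe_convolution ρ rfl (fun n s => rothePoly_sub ρ s n) n r s

theorem rotheSeries_mul_shiftedChooseSeries (ρ r s : ℝ) :
    rotheSeries ρ r * shiftedChooseSeries ρ s = shiftedChooseSeries ρ (r + s) := by
  ext n
  simp only [rotheSeries, shiftedChooseSeries, PowerSeries.coeff_mul, PowerSeries.coeff_mk]
  exact rothe_convolution ρ (by simp [shiftedChoosePoly])
    (fun n s => shiftedChoosePoly_sub ρ s n) n r s

theorem rotheSeries_zero (ρ : ℝ) : rotheSeries ρ 0 = 1 := by
  ext n
  cases n with
  | zero => simp [rotheSeries, rothePoly]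
  | succ n => simp [rotheSeries, eval_rothePoly_succ, PowerSeries.coeff_one]

/-- The operator `x d/dx` on power series. -/
noncomputable def eulerOp : Derivation ℝ (PowerSeries ℝ) (PowerSeries ℝ) :=
  (PowerSeries.X : PowerSeries ℝ) • PowerSeries.derivative ℝ

theorem coeff_eulerOp (f : PowerSeries ℝ) (n : ℕ) :
    PowerSeries.coeff n (eulerOp f) = n * PowerSeries.coeff n f := by
  rw [eulerOp, Derivation.smul_apply, smul_eq_mul]
  cases n with
  | zero => simp
  | succ n =>
    rw [PowerSeries.coeff_succ_X_mul, PowerSeries.coeff_derivative]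
    push_cast
    ring

/-- The generating function of the total weights `nρ (nρ + 1) ⋯ (nρ + n - 1)`, divided by `n!`, of
all mappings of `n` points. -/
noncomputable def weightSeries (ρ : ℝ) : PowerSeries ℝ :=
  PowerSeries.mk fun n => (ascPochhammer ℝ n).eval (n * ρ) / n.factorial

theorem shiftedChooseSeries_neg_one (ρ : ℝ) :
    shiftedChooseSeries ρ (-1) = weightSeries ρ := by
  ext n
  rw [shiftedChooseSeries, weightSeries, PowerSeries.coeff_mk, PowerSeries.coeff_mk,
    eval_shiftedChoosePoly]
  congr 2
  ring

/-- The differential equation `ρ θF = F (F - 1) ((ρ + 1) F - 1)` of the weight series `F`, where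
`θ = x d/dx` is the Euler operator. With the
generalized binomial series `B`, which satisfies `B = 1 + x B ^ (1 + ρ)`, it follows from
`F (1 - ρ (B - 1)) = 1` and `θB = (B - 1) B F`. -/
theorem eulerOp_weightSeries (ρ : ℝ) (hρ : ρ ≠ 0) :
    eulerOp (weightSeries ρ) = weightSeries ρ * (PowerSeries.C ρ⁻¹ *
      ((weightSeries ρ - 1) * (PowerSeries.C (ρ + 1) * weightSeries ρ - 1))) := by
  set F := weightSeries ρ
  set B := rotheSeries ρ 1
  have hB : rotheSeries ρ (-1) * B = 1 := by
    rw [rotheSeries_mul]; norm_num [rotheSeries_zero]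
  have hc0 : shiftedChooseSeries ρ 0 = B * F := by
    rw [show F = _ from (shiftedChooseSeries_neg_one ρ).symm, rotheSeries_mul_shiftedChooseSeries]
    norm_num
  have hc1 : shiftedChooseSeries ρ 1 = B * (B * F) := by
    rw [← hc0, rotheSeries_mul_shiftedChooseSeries]; norm_num
  have hX : PowerSeries.X * rotheSeries ρ (1 + ρ) = B - 1 := by
    ext n
    cases n with
    | zero => simp [B, rotheSeries, rothePoly]
    | succ n =>
      rw [PowerSeries.coeff_succ_X_mul, map_sub, PowerSeries.coeff_one, if_neg (by omega),
        sub_zero, coeff_rotheSeries, coeff_rotheSeries, ← rothePoly_sub, sub_self, eval_rothePoly_succ ρ 0]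
      simp
  have hθ1 : eulerOp B = PowerSeries.X * shiftedChooseSeries ρ (1 + ρ) := by
    ext n
    cases n with
    | zero => simp [coeff_eulerOp]
    | succ n =>
      rw [coeff_eulerOp, PowerSeries.coeff_succ_X_mul, coeff_rotheSeries,
        coeff_shiftedChooseSeries, eval_rothePoly_succ, eval_shiftedChoosePoly,
        Nat.factorial_succ, show 1 + ρ * ((n : ℝ) + 1) + 1 = 1 + ρ + ρ * n + 1 by ring]
      push_cast
      have : (n.factorial : ℝ) ≠ 0 := by positivity
      field_simp
  have hθ2 : PowerSeries.C (1 + ρ) * eulerOp B + B = shiftedChooseSeries ρ 1 := by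
    ext n
    cases n with
    | zero =>
      rw [map_add, PowerSeries.coeff_C_mul, coeff_eulerOp, coeff_rotheSeries,
        coeff_shiftedChooseSeries]
      simp [shiftedChoosePoly, rothePoly]
    | succ n =>
      rw [map_add, PowerSeries.coeff_C_mul, coeff_eulerOp, coeff_rotheSeries,
        coeff_shiftedChooseSeries, eval_rothePoly_succ, eval_shiftedChoosePoly,
        ascPochhammer_succ_eval]
      push_cast
      rw [show 1 + ρ * ((n : ℝ) + 1) + 1 = 1 + ρ * (n + 1) + 1 by ring]
      ring
  have hθ3 : eulerOp B = (B - 1) * (B * F) := by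
    rw [hθ1, ← hX, ← hc0, mul_assoc, rotheSeries_mul_shiftedChooseSeries]
    norm_num
  have hC1 : PowerSeries.C (1 + ρ) = 1 + PowerSeries.C ρ := by simp
  have hF : F * (1 - PowerSeries.C ρ * (B - 1)) = 1 := by
    rw [hθ3, hc1, hC1] at hθ2
    linear_combination (-rotheSeries ρ (-1)) * hθ2 +
      (1 + (1 + PowerSeries.C ρ) * (B - 1) * F - B * F) * hB
  have hD : eulerOp F * (1 - PowerSeries.C ρ * (B - 1)) - F * PowerSeries.C ρ * eulerOp B = 0 := by
    have h := congrArg eulerOp hF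
    rw [Derivation.leibniz, map_sub, Derivation.leibniz, map_sub, Derivation.map_one_eq_zero] at h
    have hC : eulerOp (PowerSeries.C ρ) = 0 := by
      ext n
      rw [coeff_eulerOp, PowerSeries.coeff_C]
      split_ifs with h
      · simp [h]
      · simp
    rw [hC] at h
    simp only [smul_eq_mul] at h
    linear_combination h
  have hCρ : PowerSeries.C ρ⁻¹ * PowerSeries.C ρ = 1 := by
    rw [← map_mul, inv_mul_cancel₀ hρ, map_one]
  have hC2 : PowerSeries.C (ρ + 1) = PowerSeries.C ρ + 1 := by simp
  -- `ρ F (B - 1) = F - 1` and `ρ F B = (ρ + 1) F - 1` turn the derivative of `F (1 - ρ (B - 1)) = 1`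
  -- into a polynomial in `F`
  have h1 : PowerSeries.C ρ * F * (B - 1) = F - 1 := by linear_combination -hF
  have h2 : PowerSeries.C ρ * F * B = (PowerSeries.C ρ + 1) * F - 1 := by linear_combination h1
  have h3 : PowerSeries.C ρ * eulerOp F = F * ((F - 1) * ((PowerSeries.C ρ + 1) * F - 1)) := by
    rw [← h2, ← h1]
    rw [hθ3] at hD
    linear_combination (-PowerSeries.C ρ * eulerOp F) * hF + PowerSeries.C ρ * F * hD
  rw [hC2]
  linear_combination PowerSeries.C ρ⁻¹ * h3 - eulerOp F * hCρ

/-! ### Asymptotics of the coefficients -/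

/-- The logarithm of the ratio of `Γ x` and its Stirling approximation, up to a constant. -/
noncomputable def stirlingError (x : ℝ) : ℝ :=
  Real.log (Real.Gamma x) - ((x - 1 / 2) * Real.log x - x)

theorem stirlingError_sub {x : ℝ} (hx : 0 < x) :
    stirlingError x - stirlingError (x + 1) = (x + 1 / 2) * Real.log (1 + 1 / x) - 1 := by
  have h1 : Real.log (1 + 1 / x) = Real.log (x + 1) - Real.log x := by
    rw [← Real.log_div (by positivity) hx.ne']
    congr 1
    field_simp
  rw [stirlingError, stirlingError, Real.Gamma_add_one hx.ne',
    Real.log_mul hx.ne' (Real.Gamma_pos_of_pos hx).ne', h1]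
  ring

theorem stirlingError_sub_nonneg {x : ℝ} (hx : 0 < x) :
    stirlingError (x + 1) ≤ stirlingError x := by
  rw [← sub_nonneg, stirlingError_sub hx]
  have h := Real.le_log_one_add_of_nonneg (x := 1 / x) (by positivity)
  have h2 : 2 * (1 / x) / (1 / x + 2) = 1 / (x + 1 / 2) := by field_simp; ring
  rw [h2, div_le_iff₀ (by positivity)] at h
  linarith

theorem stirlingError_sub_le {x : ℝ} (hx : 0 < x) :
    stirlingError x - 1 / x ≤ stirlingError (x + 1) - 1 / (x + 1) := by
  suffices h : stirlingError x - stirlingError (x + 1) ≤ 1 / x - 1 / (x + 1) by linarith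
  rw [stirlingError_sub hx]
  set y : ℝ := 1 / (2 * x + 1) with hy
  have hy0 : 0 ≤ y := by positivity
  have hy1 : y ^ 2 < 1 := by
    rw [sq_lt_one_iff₀ hy0, hy, div_lt_one (by positivity)]
    linarith
  have h1 := (Real.hasSum_log_one_add_inv hx).mul_left (x + 1 / 2)
  have h2 : HasSum (fun k : ℕ => (y ^ 2) ^ k) (1 - y ^ 2)⁻¹ :=
    hasSum_geometric_of_lt_one (by positivity) hy1
  have h3 := hasSum_le (fun k => ?_) h1 h2
  · have h4 : (1 - y ^ 2)⁻¹ = 1 + 1 / (4 * x * (x + 1)) := by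
      rw [hy]
      have : (1 : ℝ) - (1 / (2 * x + 1)) ^ 2 = 4 * x * (x + 1) / (2 * x + 1) ^ 2 := by
        field_simp
        ring
      rw [this]
      field_simp
      ring
    have h5 : 1 / (4 * x * (x + 1)) ≤ 1 / (x * (x + 1)) := by
      apply one_div_le_one_div_of_le (by positivity)
      nlinarith
    have h6 : 1 / x - 1 / (x + 1) = 1 / (x * (x + 1)) := by field_simp; ring
    rw [h4] at h3
    simp only [one_div] at h3 h5 h6 ⊢
    linarith
  · have h7 : (x + 1 / 2) * (2 * (1 / (2 * (k : ℝ) + 1)) * (1 / (2 * x + 1)) ^ (2 * k + 1)) =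
        1 / (2 * k + 1) * (y ^ 2) ^ k := by
      rw [← hy, pow_succ, pow_mul]
      have : (x + 1 / 2) * (2 * y) = 1 := by rw [hy]; field_simp
      linear_combination (1 / (2 * (k : ℝ) + 1) * (y ^ 2) ^ k) * this
    rw [h7]
    refine mul_le_of_le_one_left (by positivity) ?_
    rw [div_le_one (by positivity)]
    linarith [(Nat.cast_nonneg k : (0 : ℝ) ≤ k)]

/-- Stirling's formula for the Gamma function, up to a bounded factor. -/
theorem exists_abs_stirlingError_le {δ : ℝ} (hδ : 0 < δ) :
    ∃ K, ∀ x, δ ≤ x → |stirlingError x| ≤ K := by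
  have hcont : ContinuousOn stirlingError (Set.Icc δ (δ + 1)) := by
    intro x hx
    have hx0 : 0 < x := hδ.trans_le hx.1
    have h1 : ContinuousAt Real.Gamma x :=
      (Real.differentiableAt_Gamma fun m => by
        have : (0 : ℝ) ≤ m := Nat.cast_nonneg m
        intro h
        linarith).continuousAt
    refine ContinuousAt.continuousWithinAt ?_
    unfold stirlingError
    exact (h1.log (Real.Gamma_pos_of_pos hx0).ne').sub
      (((continuousAt_id.sub continuousAt_const).mul (Real.continuousAt_log hx0.ne')).sub
        continuousAt_id)
  obtain ⟨K, hK⟩ := isCompact_Icc.exists_bound_of_continuousOn hcont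
  refine ⟨K + 1 / δ, fun x hx => ?_⟩
  set n := ⌊x - δ⌋₊ with hn
  have hn1 : (n : ℝ) ≤ x - δ := Nat.floor_le (by linarith)
  have hn2 : x - δ < n + 1 := Nat.lt_floor_add_one _
  have key : ∀ m : ℕ, ∀ y, 0 < y → stirlingError (y + m) ≤ stirlingError y ∧
      stirlingError y - 1 / y ≤ stirlingError (y + m) - 1 / (y + m) := by
    intro m y hy
    induction m with
    | zero => simp
    | succ m ih =>
      have hm : 0 < y + m := by positivity
      have e : y + (m + 1 : ℕ) = y + m + 1 := by push_cast; ring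
      rw [e]
      exact ⟨(stirlingError_sub_nonneg hm).trans ih.1, ih.2.trans (stirlingError_sub_le hm)⟩
  have hy : x - n ∈ Set.Icc δ (δ + 1) := ⟨by linarith, by linarith⟩
  have hy0 : 0 < x - n := hδ.trans_le hy.1
  have h1 := key n (x - n) hy0
  rw [sub_add_cancel] at h1
  have h2 := abs_le.1 (hK _ hy)
  have h3 : 1 / (x - n) ≤ 1 / δ := one_div_le_one_div_of_le hδ hy.1
  have h4 : 0 < 1 / x := by have := hδ.trans_le hx; positivity
  have h5 : 0 < 1 / δ := by positivity
  rw [abs_le]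
  constructor <;> linarith [h1.1, h1.2, h2.1, h2.2]

theorem Gamma_add_nat {x : ℝ} (hx : 0 < x) (n : ℕ) :
    Real.Gamma (x + n) = (ascPochhammer ℝ n).eval x * Real.Gamma x := by
  induction n with
  | zero => simp
  | succ n ih =>
    rw [ascPochhammer_succ_eval, Nat.cast_succ, ← add_assoc, Real.Gamma_add_one (by positivity), ih]
    ring

theorem coeff_weightSeries (ρ : ℝ) (n : ℕ) : PowerSeries.coeff n (weightSeries ρ) =
    (ascPochhammer ℝ n).eval (n * ρ) / n.factorial :=
  PowerSeries.coeff_mk _ _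

theorem coeff_weightSeries_pos {ρ : ℝ} (hρ : 0 < ρ) (n : ℕ) :
    0 < PowerSeries.coeff n (weightSeries ρ) := by
  rw [coeff_weightSeries]
  cases n with
  | zero => simp
  | succ n =>
    have := ascPochhammer_pos (n + 1) (((n + 1 : ℕ) : ℝ) * ρ) (by positivity)
    positivity

/-- The coefficients of `weightSeries ρ` are of the order `α ^ n / √n`, where `log α` is
`(ρ + 1) log (ρ + 1) - ρ log ρ`. -/
theorem exists_coeff_weightSeries_bounds {ρ : ℝ} (hρ : 0 < ρ) :
    ∃ α c C : ℝ, 0 < α ∧ 0 < c ∧ 0 < C ∧ ∀ n : ℕ, n ≠ 0 →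
      c * (α ^ n / √n) ≤ PowerSeries.coeff n (weightSeries ρ) ∧
      PowerSeries.coeff n (weightSeries ρ) ≤ C * (α ^ n / √n) := by
  obtain ⟨K, hK⟩ := exists_abs_stirlingError_le (lt_min hρ one_pos)
  set lα := (ρ + 1) * Real.log (ρ + 1) - ρ * Real.log ρ with hlα
  set b := (Real.log ρ - Real.log (ρ + 1)) / 2 with hb
  refine ⟨Real.exp lα, Real.exp (b - 3 * K), Real.exp (b + 3 * K), Real.exp_pos _, Real.exp_pos _,
    Real.exp_pos _, fun n hn => ?_⟩
  have hn1 : (1 : ℝ) ≤ n := by exact_mod_cast Nat.one_le_iff_ne_zero.2 hn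
  have hn0 : (0 : ℝ) < n := by linarith
  have h1 := hK n ((min_le_right _ _).trans hn1)
  have h2 := hK (n * ρ) ((min_le_left _ _).trans (by nlinarith))
  have h3 := hK (n * ρ + n) ((min_le_left _ _).trans (by nlinarith))
  have hG : ∀ {x : ℝ}, 0 < x → 0 < Real.Gamma x := Real.Gamma_pos_of_pos
  have hw : PowerSeries.coeff n (weightSeries ρ) =
      Real.Gamma (n * ρ + n) / (Real.Gamma (n * ρ) * (n * Real.Gamma n)) := by
    rw [coeff_weightSeries, ← Real.Gamma_add_one hn0.ne', Real.Gamma_nat_eq_factorial,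
      Gamma_add_nat (by positivity)]
    have := hG (show 0 < (n : ℝ) * ρ by positivity)
    field_simp
  have hlog : Real.log (PowerSeries.coeff n (weightSeries ρ)) =
      n * lα - Real.log n / 2 + b +
        (stirlingError (n * ρ + n) - stirlingError (n * ρ) - stirlingError n) := by
    have p1 := hG (show 0 < (n : ℝ) * ρ by positivity)
    have p2 := hG hn0
    have p3 := hG (show 0 < (n : ℝ) * ρ + n by positivity)
    rw [hw, Real.log_div p3.ne' (by positivity), Real.log_mul p1.ne' (by positivity),
      Real.log_mul hn0.ne' p2.ne', stirlingError, stirlingError, stirlingError,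
      show (n : ℝ) * ρ + n = n * (ρ + 1) by ring, Real.log_mul hn0.ne' hρ.ne',
      Real.log_mul hn0.ne' (by positivity : ρ + 1 ≠ 0), hlα, hb]
    ring
  have hexp : ∀ z, Real.exp z * (Real.exp lα ^ n / √n) =
      Real.exp (n * lα - Real.log n / 2 + z) := by
    intro z
    rw [← Real.exp_nat_mul, Real.exp_add, Real.exp_sub, Real.sqrt_eq_rpow,
      Real.rpow_def_of_pos hn0, mul_comm (Real.exp z)]
    congr 4
    ring
  rw [hexp, hexp, ← Real.exp_log (coeff_weightSeries_pos hρ n), Real.exp_le_exp, Real.exp_le_exp,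
    hlog]
  rw [abs_le] at h1 h2 h3
  constructor <;> linarith

theorem sum_one_div_sqrt_le (n : ℕ) : ∑ k ∈ Finset.range n, 1 / √((k + 1 : ℕ) : ℝ) ≤ 2 * √n := by
  induction n with
  | zero => simp
  | succ n ih =>
    rw [Finset.sum_range_succ]
    have h1 : 0 < √((n + 1 : ℕ) : ℝ) := by positivity
    have h2 : √(n : ℝ) ≤ √((n + 1 : ℕ) : ℝ) := Real.sqrt_le_sqrt (by simp)
    have h3 := Real.sq_sqrt (Nat.cast_nonneg n : (0 : ℝ) ≤ n)
    have h4 := Real.sq_sqrt (Nat.cast_nonneg (n + 1) : (0 : ℝ) ≤ (n + 1 : ℕ))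
    have h5 : 1 / √((n + 1 : ℕ) : ℝ) ≤ 2 * (√((n + 1 : ℕ) : ℝ) - √(n : ℝ)) := by
      rw [div_le_iff₀ h1]
      push_cast at *
      nlinarith
    linarith

/-- The convolution square of `1 / √n` is bounded. -/
theorem sum_one_div_sqrt_mul_le (n : ℕ) :
    ∑ k ∈ Finset.range n, 1 / √((k + 1 : ℕ) : ℝ) * (1 / √((n - k : ℕ) : ℝ)) ≤ 8 := by
  rcases Nat.eq_zero_or_pos n with rfl | hn
  · simp
  have hn0 : 0 < √(n : ℝ) := by positivity
  have hsq := Real.sq_sqrt (Nat.cast_nonneg n : (0 : ℝ) ≤ n)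
  -- one of the two factors is at most `2 / √n`
  have h1 : ∀ k ∈ Finset.range n, 1 / √((k + 1 : ℕ) : ℝ) * (1 / √((n - k : ℕ) : ℝ)) ≤
      2 / √n * (1 / √((k + 1 : ℕ) : ℝ) + 1 / √((n - k : ℕ) : ℝ)) := by
    intro k hk
    have hkn := Finset.mem_range.1 hk
    have ha : 0 < √((k + 1 : ℕ) : ℝ) := by positivity
    have hb : 0 < √((n - k : ℕ) : ℝ) := Real.sqrt_pos.2 (by exact_mod_cast (by omega))
    have hle : √(n : ℝ) ≤ √((k + 1 : ℕ) : ℝ) + √((n - k : ℕ) : ℝ) := by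
      rw [Real.sqrt_le_left (by positivity)]
      have e1 := Real.sq_sqrt (Nat.cast_nonneg (k + 1) : (0 : ℝ) ≤ (k + 1 : ℕ))
      have e2 := Real.sq_sqrt (Nat.cast_nonneg (n - k) : (0 : ℝ) ≤ (n - k : ℕ))
      have e3 : (n : ℝ) ≤ ((k + 1 : ℕ) : ℝ) + ((n - k : ℕ) : ℝ) := by
        exact_mod_cast (by omega : n ≤ k + 1 + (n - k))
      nlinarith
    rw [div_add_div _ _ ha.ne' hb.ne', div_mul_div_comm, div_mul_div_comm,
      div_le_div_iff₀ (by positivity) (by positivity)]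
    have := mul_pos ha hb
    nlinarith
  have h2 : ∑ k ∈ Finset.range n, 1 / √((n - k : ℕ) : ℝ) =
      ∑ k ∈ Finset.range n, 1 / √((k + 1 : ℕ) : ℝ) := by
    rw [← Finset.sum_range_reflect]
    refine Finset.sum_congr rfl fun k hk => ?_
    have := Finset.mem_range.1 hk
    rw [show n - (n - 1 - k) = k + 1 by omega]
  refine (Finset.sum_le_sum h1).trans ?_
  rw [← Finset.mul_sum, Finset.sum_add_distrib, h2]
  have h3 := sum_one_div_sqrt_le n
  calc 2 / √(n : ℝ) * _ ≤ 2 / √(n : ℝ) * (2 * √n + 2 * √n) := by gcongr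
    _ = 8 := by field_simp; norm_num

/-- The `n`-th coefficient of the `a`-th power of the weight series, divided by the order of
magnitude that it has for `a ≥ 1`. -/
noncomputable def powerRatio (ρ : ℝ) (a n : ℕ) : ℝ :=
  PowerSeries.coeff n (weightSeries ρ ^ a) /
    (PowerSeries.coeff n (weightSeries ρ) * √(n : ℝ) ^ (a - 1))

theorem coeff_weightSeries_pow_nonneg {ρ : ℝ} (hρ : 0 < ρ) (a n : ℕ) :
    0 ≤ PowerSeries.coeff n (weightSeries ρ ^ a) := by
  induction a generalizing n with
  | zero => rw [pow_zero, PowerSeries.coeff_one]; split_ifs <;> norm_num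
  | succ a ih =>
    rw [pow_succ, PowerSeries.coeff_mul]
    exact Finset.sum_nonneg fun q _ => mul_nonneg (ih _) (coeff_weightSeries_pos hρ _).le

theorem powerRatio_nonneg {ρ : ℝ} (hρ : 0 < ρ) (a n : ℕ) : 0 ≤ powerRatio ρ a n :=
  div_nonneg (coeff_weightSeries_pow_nonneg hρ a n)
    (mul_nonneg (coeff_weightSeries_pos hρ n).le (by positivity))

theorem powerRatio_one {ρ : ℝ} (hρ : 0 < ρ) (n : ℕ) : powerRatio ρ 1 n = 1 := by
  simp [powerRatio, (coeff_weightSeries_pos hρ n).ne']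

/-- The coefficients of the square are bounded by the convolution square of `α ^ n / √n`. This
is the second initial value for the recursion `powerRatio_add_three`, whose first one is `1`. -/
theorem exists_powerRatio_two_le {ρ : ℝ} (hρ : 0 < ρ) :
    ∃ K, ∀ n : ℕ, n ≠ 0 → powerRatio ρ 2 n ≤ K := by
  obtain ⟨α, c, C, hα, hc, hC, hw⟩ := exists_coeff_weightSeries_bounds hρ
  refine ⟨2 + 8 * C ^ 2 / c, fun n hn => ?_⟩
  set w := fun n => PowerSeries.coeff n (weightSeries ρ) with hwdef
  have hwpos : ∀ n, 0 < w n := coeff_weightSeries_pos hρ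
  have hw0 : w 0 = 1 := by simp [hwdef, coeff_weightSeries]
  obtain ⟨m, rfl⟩ := Nat.exists_eq_succ_of_ne_zero hn
  have hs : 1 ≤ √((m + 1 : ℕ) : ℝ) := by
    rw [Real.one_le_sqrt]
    exact_mod_cast Nat.succ_le_succ (Nat.zero_le m)
  have h1 : PowerSeries.coeff (m + 1) (weightSeries ρ ^ 2) =
      2 * w (m + 1) + ∑ k ∈ Finset.range m, w (k + 1) * w (m - k) := by
    rw [pow_two, PowerSeries.coeff_mul, Finset.Nat.sum_antidiagonal_eq_sum_range_succ
      (f := fun i j => w i * w j), Finset.sum_range_succ, Finset.sum_range_succ']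
    rw [Nat.sub_self, Nat.sub_zero, hw0]
    have : ∀ k ∈ Finset.range m, w (k + 1) * w (m + 1 - (k + 1)) = w (k + 1) * w (m - k) := by
      intro k _
      rw [Nat.add_sub_add_right]
    rw [Finset.sum_congr rfl this]
    ring
  have h2 : ∑ k ∈ Finset.range m, w (k + 1) * w (m - k) ≤ C ^ 2 * α ^ (m + 1) * 8 := by
    refine le_trans (Finset.sum_le_sum fun k hk => ?_)
      ((Finset.mul_sum _ _ _).symm.le.trans
        (mul_le_mul_of_nonneg_left (sum_one_div_sqrt_mul_le m) (by positivity)))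
    have hk := Finset.mem_range.1 hk
    refine (mul_le_mul (hw (k + 1) (by omega)).2 (hw (m - k) (by omega)).2 (hwpos _).le
      (by positivity)).trans_eq ?_
    rw [show m + 1 = (k + 1) + (m - k) by omega, pow_add α (k + 1) (m - k)]
    ring
  have h3 := (hw (m + 1) hn).1
  have h4 : α ^ (m + 1) ≤ w (m + 1) * √((m + 1 : ℕ) : ℝ) / c := by
    rw [le_div_iff₀ hc, mul_comm]
    rw [← mul_div_assoc, div_le_iff₀ (by positivity)] at h3
    exact h3
  rw [powerRatio, div_le_iff₀ (mul_pos (hwpos _) (by positivity)), h1, pow_one]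
  have h5 : C ^ 2 * α ^ (m + 1) * 8 ≤
      C ^ 2 * (w (m + 1) * √((m + 1 : ℕ) : ℝ) / c) * 8 := by gcongr
  have h6 : 2 * w (m + 1) ≤ 2 * (w (m + 1) * √((m + 1 : ℕ) : ℝ)) := by
    have := le_mul_of_one_le_right (hwpos (m + 1)).le hs
    linarith
  calc _ ≤ 2 * (w (m + 1) * √((m + 1 : ℕ) : ℝ)) +
      C ^ 2 * (w (m + 1) * √((m + 1 : ℕ) : ℝ) / c) * 8 := by linarith
    _ = _ := by simp only [hwdef]; ring

/-- The differential equation for the weight series, as a recursion for the coefficients of its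
powers. -/
theorem coeff_weightSeries_pow {ρ : ℝ} (hρ : 0 < ρ) (a n : ℕ) :
    ρ * n * PowerSeries.coeff n (weightSeries ρ ^ (a + 1)) =
      (a + 1) * ((ρ + 1) * PowerSeries.coeff n (weightSeries ρ ^ (a + 3)) -
        (ρ + 2) * PowerSeries.coeff n (weightSeries ρ ^ (a + 2)) +
        PowerSeries.coeff n (weightSeries ρ ^ (a + 1))) := by
  set F := weightSeries ρ with hF
  have h : PowerSeries.C ρ * eulerOp (F ^ (a + 1)) = PowerSeries.C ((a : ℝ) + 1) *
      (PowerSeries.C (ρ + 1) * F ^ (a + 3) - PowerSeries.C (ρ + 2) * F ^ (a + 2) +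
        F ^ (a + 1)) := by
    rw [Derivation.leibniz_pow, hF, eulerOp_weightSeries ρ hρ.ne', ← hF]
    have h1 : PowerSeries.C ρ * PowerSeries.C ρ⁻¹ = 1 := by
      rw [← map_mul, mul_inv_cancel₀ hρ.ne', map_one]
    simp only [map_add, map_one, map_natCast, map_ofNat, nsmul_eq_mul, smul_eq_mul,
      Nat.add_sub_cancel, Nat.cast_add, Nat.cast_one]
    linear_combination (((a : PowerSeries ℝ) + 1) * F ^ (a + 1) * ((F - 1) *
      ((PowerSeries.C ρ + 1) * F - 1))) * h1
  have h2 := congrArg (PowerSeries.coeff n) h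
  rw [PowerSeries.coeff_C_mul, PowerSeries.coeff_C_mul, coeff_eulerOp,
    map_add (PowerSeries.coeff n), map_sub (PowerSeries.coeff n), PowerSeries.coeff_C_mul,
    PowerSeries.coeff_C_mul] at h2
  linarith

theorem powerRatio_add_three {ρ : ℝ} (hρ : 0 < ρ) (a : ℕ) {n : ℕ} (hn : n ≠ 0) :
    powerRatio ρ (a + 3) n = ρ / ((ρ + 1) * (a + 1)) * powerRatio ρ (a + 1) n +
      ((ρ + 2) / (ρ + 1) * powerRatio ρ (a + 2) n * (1 / √(n : ℝ)) -
        1 / (ρ + 1) * powerRatio ρ (a + 1) n * (1 / √(n : ℝ)) ^ 2) := by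
  have hs : 0 < √(n : ℝ) := Real.sqrt_pos.2 (by exact_mod_cast Nat.pos_of_ne_zero hn)
  have hsq := Real.sq_sqrt (Nat.cast_nonneg n : (0 : ℝ) ≤ n)
  have hw := coeff_weightSeries_pos hρ n
  have h := coeff_weightSeries_pow hρ a n
  rw [← hsq] at h
  simp only [powerRatio, Nat.add_sub_cancel, show a + 3 - 1 = a + 2 by omega,
    show a + 2 - 1 = a + 1 by omega]
  have e : PowerSeries.coeff n (weightSeries ρ ^ (a + 3)) =
      (ρ * √(n : ℝ) ^ 2 * PowerSeries.coeff n (weightSeries ρ ^ (a + 1)) / (a + 1) +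
        (ρ + 2) * PowerSeries.coeff n (weightSeries ρ ^ (a + 2)) -
        PowerSeries.coeff n (weightSeries ρ ^ (a + 1))) / (ρ + 1) := by
    field_simp
    linear_combination -h
  rw [e]
  field_simp
  ring

theorem exists_powerRatio_le {ρ : ℝ} (hρ : 0 < ρ) (a : ℕ) :
    ∃ K, ∀ n : ℕ, n ≠ 0 → powerRatio ρ (a + 1) n ≤ K := by
  suffices h : (∃ K, ∀ n : ℕ, n ≠ 0 → powerRatio ρ (a + 1) n ≤ K) ∧
      ∃ K, ∀ n : ℕ, n ≠ 0 → powerRatio ρ (a + 2) n ≤ K from h.1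
  induction a with
  | zero => exact ⟨⟨1, fun n _ => (powerRatio_one hρ n).le⟩, exists_powerRatio_two_le hρ⟩
  | succ a ih =>
    refine ⟨ih.2, ?_⟩
    obtain ⟨⟨K, hK⟩, ⟨K', hK'⟩⟩ := ih
    refine ⟨ρ / ((ρ + 1) * (a + 1)) * K + (ρ + 2) / (ρ + 1) * K', fun n hn => ?_⟩
    have h1 : 1 / √(n : ℝ) ≤ 1 := by
      have : 1 ≤ √(n : ℝ) := by
        rw [Real.one_le_sqrt]
        exact_mod_cast Nat.one_le_iff_ne_zero.2 hn
      exact div_le_one_of_le₀ this (by positivity)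
    rw [show a + 1 + 2 = a + 3 by ring, powerRatio_add_three hρ a hn]
    have h2 := powerRatio_nonneg hρ (a + 1) n
    have h3 := powerRatio_nonneg hρ (a + 2) n
    have h4 : 0 ≤ 1 / (ρ + 1) * powerRatio ρ (a + 1) n * (1 / √(n : ℝ)) ^ 2 := by positivity
    have h5 : ρ / ((ρ + 1) * (a + 1)) * powerRatio ρ (a + 1) n ≤ ρ / ((ρ + 1) * (a + 1)) * K :=
      mul_le_mul_of_nonneg_left (hK n hn) (by positivity)
    have h6 : (ρ + 2) / (ρ + 1) * powerRatio ρ (a + 2) n * (1 / √(n : ℝ)) ≤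
        (ρ + 2) / (ρ + 1) * K' :=
      (mul_le_of_le_one_right (by positivity) h1).trans
        (mul_le_mul_of_nonneg_left (hK' n hn) (by positivity))
    linarith

theorem tendsto_one_div_sqrt_natCast : Tendsto (fun n : ℕ => 1 / √(n : ℝ)) atTop (𝓝 0) := by
  simpa [Function.comp_def] using
    (tendsto_inv_atTop_zero.comp Real.tendsto_sqrt_atTop).comp tendsto_natCast_atTop_atTop

theorem tendsto_powerRatio_mul {ρ : ℝ} (hρ : 0 < ρ) (a : ℕ) {u : ℕ → ℝ}
    (hu : Tendsto u atTop (𝓝 0)) :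
    Tendsto (fun n => powerRatio ρ (a + 1) n * u n) atTop (𝓝 0) := by
  obtain ⟨K, hK⟩ := exists_powerRatio_le hρ a
  refine squeeze_zero_norm' (a := fun n => K * ‖u n‖) ?_ (by simpa using hu.norm.const_mul K)
  filter_upwards [eventually_ne_atTop 0] with n hn
  rw [norm_mul, Real.norm_of_nonneg (powerRatio_nonneg hρ _ _)]
  exact mul_le_mul_of_nonneg_right (hK n hn) (norm_nonneg _)

/-- The limit of `powerRatio ρ (2 * j + 1)`. -/
noncomputable def powerRatioLimit (ρ : ℝ) (j : ℕ) : ℝ :=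
  ∏ i ∈ Finset.range j, ρ / ((ρ + 1) * (2 * i + 1))

theorem tendsto_powerRatio {ρ : ℝ} (hρ : 0 < ρ) (j : ℕ) :
    Tendsto (powerRatio ρ (2 * j + 1)) atTop (𝓝 (powerRatioLimit ρ j)) := by
  induction j with
  | zero =>
    simp only [powerRatioLimit, Finset.range_zero, Finset.prod_empty]
    exact tendsto_const_nhds.congr fun n => (powerRatio_one hρ n).symm
  | succ j ih =>
    have h1 := tendsto_powerRatio_mul hρ (2 * j + 1) tendsto_one_div_sqrt_natCast
    have h2 := tendsto_powerRatio_mul hρ (2 * j)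
      (u := fun n => (1 / √(n : ℝ)) ^ 2) (by simpa using tendsto_one_div_sqrt_natCast.pow 2)
    have h3 := (ih.const_mul (ρ / ((ρ + 1) * (2 * j + 1)))).add
      ((h1.const_mul ((ρ + 2) / (ρ + 1))).sub (h2.const_mul (1 / (ρ + 1))))
    have h4 : powerRatioLimit ρ (j + 1) = ρ / ((ρ + 1) * (2 * j + 1)) * powerRatioLimit ρ j := by
      rw [powerRatioLimit, Finset.prod_range_succ, mul_comm, powerRatioLimit]
    rw [h4]
    simp only [mul_zero, sub_zero, add_zero] at h3
    refine h3.congr' ?_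
    filter_upwards [eventually_ne_atTop 0] with n hn
    rw [show 2 * (j + 1) + 1 = 2 * j + 3 by ring, powerRatio_add_three hρ (2 * j) hn]
    push_cast
    ring

/-- The coefficients of a polynomial of degree at most `2 M + 1` in the weight series are governed
by its leading coefficient. -/
theorem tendsto_coeff_aeval_weightSeries {ρ : ℝ} (hρ : 0 < ρ) (M : ℕ) (P : Polynomial ℝ)
    (hP : P.natDegree ≤ 2 * M + 1) :
    Tendsto (fun n : ℕ => PowerSeries.coeff n (Polynomial.aeval (weightSeries ρ) P) /
      (PowerSeries.coeff n (weightSeries ρ) * (n : ℝ) ^ M)) atTop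
      (𝓝 (P.coeff (2 * M + 1) * powerRatioLimit ρ M)) := by
  have hlow : ∀ a ∈ Finset.range (2 * M + 1), Tendsto (fun n : ℕ =>
      P.coeff a * (PowerSeries.coeff n (weightSeries ρ ^ a) /
        (PowerSeries.coeff n (weightSeries ρ) * (n : ℝ) ^ M))) atTop (𝓝 0) := by
    intro a ha
    have ha := Finset.mem_range.1 ha
    rw [show (0 : ℝ) = P.coeff a * 0 by ring]
    refine Tendsto.const_mul _ ?_
    rcases a with _ | a
    · refine tendsto_const_nhds.congr' ?_
      filter_upwards [eventually_ne_atTop 0] with n hn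
      simp [PowerSeries.coeff_one, hn]
    · have h := tendsto_powerRatio_mul hρ a (u := fun n => (1 / √(n : ℝ)) ^ (2 * M - a))
        (by simpa [show 2 * M - a ≠ 0 by omega] using
          tendsto_one_div_sqrt_natCast.pow (2 * M - a))
      refine h.congr' ?_
      filter_upwards [eventually_ne_atTop 0] with n hn
      have hs : 0 < √(n : ℝ) := Real.sqrt_pos.2 (by exact_mod_cast Nat.pos_of_ne_zero hn)
      have hsq := Real.sq_sqrt (Nat.cast_nonneg n : (0 : ℝ) ≤ n)
      have hpow : (n : ℝ) ^ M = √(n : ℝ) ^ a * √(n : ℝ) ^ (2 * M - a) := by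
        rw [← pow_add, Nat.add_sub_cancel' (by omega), pow_mul, hsq]
      rw [powerRatio, hpow, Nat.add_sub_cancel, one_div, inv_pow]
      have hw := coeff_weightSeries_pos hρ n
      field_simp
  have htop : Tendsto (fun n : ℕ => P.coeff (2 * M + 1) *
      (PowerSeries.coeff n (weightSeries ρ ^ (2 * M + 1)) /
        (PowerSeries.coeff n (weightSeries ρ) * (n : ℝ) ^ M))) atTop
      (𝓝 (P.coeff (2 * M + 1) * powerRatioLimit ρ M)) := by
    refine Tendsto.const_mul _ ((tendsto_powerRatio hρ M).congr fun n => ?_)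
    rw [powerRatio, Nat.add_sub_cancel, pow_mul, Real.sq_sqrt (Nat.cast_nonneg n)]
  have h := (tendsto_finsetSum _ hlow).add htop
  rw [Finset.sum_const_zero, zero_add] at h
  refine h.congr fun n => ?_
  rw [Polynomial.aeval_eq_sum_range' (Nat.lt_succ_of_le hP), ← Finset.sum_range_succ (fun a =>
    P.coeff a * (PowerSeries.coeff n (weightSeries ρ ^ a) /
      (PowerSeries.coeff n (weightSeries ρ) * (n : ℝ) ^ M))), map_sum, Finset.sum_div]
  simp only [PowerSeries.coeff_smul, smul_eq_mul, mul_div_assoc]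

/-! ### Components of a mapping and their weights -/

section mapping

variable {V W : Type}

/-- A set is saturated for the mapping `f` if it is its own preimage under `f`, that is, if it is a
union of connected components of the graph of `f`. -/
def Saturated (f : V → V) (A : Finset V) : Prop := ∀ v, f v ∈ A ↔ v ∈ A

/-- Transport of a mapping along a relabelling of the vertices. -/
def relabel (e : V ≃ W) (f : V → V) : W → W := e ∘ f ∘ e.symm

theorem relabel_symm_relabel (e : V ≃ W) (f : V → V) : relabel e.symm (relabel e f) = f := by
  funext v; simp [relabel]

theorem saturated_relabel (e : V ≃ W) (f : V → V) (A : Finset V) :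
    Saturated (relabel e f) (A.map e.toEmbedding) ↔ Saturated f A := by
  simp only [Saturated, relabel, Finset.mem_map_equiv, Function.comp_apply, e.symm_apply_apply]
  exact ⟨fun h v => by simpa using h (e v), fun h v => h _⟩

theorem saturated_sumMap {g : V → V} {h : W → W} {A : Finset V} {B : Finset W} :
    Saturated (Sum.map g h) (A.disjSum B) ↔ Saturated g A ∧ Saturated h B := by
  simp [Saturated]

theorem eq_disjSum (A : Finset (V ⊕ W)) : A = A.toLeft.disjSum A.toRight :=
  (Finset.toLeft_disjSum_toRight).symm

theorem exists_sumMap_eq [Fintype V] {f : V ⊕ W → V ⊕ W}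
    (hf : Saturated f (Finset.univ.disjSum ∅)) : ∃ g h, Sum.map g h = f := by
  have h1 : ∀ v, ∃ v', f (Sum.inl v) = Sum.inl v' := by
    intro v
    have := (hf (Sum.inl v)).2 (by simp)
    rcases hx : f (Sum.inl v) with x | x
    · exact ⟨x, rfl⟩
    · simp [hx] at this
  have h2 : ∀ w, ∃ w', f (Sum.inr w) = Sum.inr w' := by
    intro w
    have := (hf (Sum.inr w)).1
    rcases hx : f (Sum.inr w) with x | x
    · simp [hx] at this
    · exact ⟨x, rfl⟩
  choose g hg using h1
  choose h hh using h2
  refine ⟨g, h, funext ?_⟩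
  rintro (x | x)
  · exact (hg x).symm
  · exact (hh x).symm

variable [Fintype V] [Fintype W]

open Classical in
/-- The connected components of the graph of `f`, as sets of vertices: the minimal nonempty
saturated sets. -/
noncomputable def mapComponents (f : V → V) : Finset (Finset V) :=
  Finset.univ.filter fun A => A.Nonempty ∧ Saturated f A ∧
    ∀ B ⊆ A, B.Nonempty → Saturated f B → B = A

/-- The sizes of the components of `f`. -/
noncomputable def compSizes (f : V → V) : Multiset ℕ := (mapComponents f).val.map Finset.card

theorem mem_mapComponents {f : V → V} {A : Finset V} : A ∈ mapComponents f ↔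
    A.Nonempty ∧ Saturated f A ∧ ∀ B ⊆ A, B.Nonempty → Saturated f B → B = A := by
  simp [mapComponents]

theorem disjoint_of_mem_mapComponents {f : V → V} {A B : Finset V} (hA : A ∈ mapComponents f)
    (hB : B ∈ mapComponents f) (hAB : A ≠ B) : Disjoint A B := by
  classical
  rw [mem_mapComponents] at hA hB
  by_contra h
  have hne : (A ∩ B).Nonempty := by rwa [Finset.nonempty_iff_ne_empty, Ne,
    ← Finset.disjoint_iff_inter_eq_empty]
  have hs : Saturated f (A ∩ B) := fun v => by
    rw [Finset.mem_inter, Finset.mem_inter, hA.2.1 v, hB.2.1 v]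
  exact hAB ((hA.2.2 _ Finset.inter_subset_left hne hs).symm.trans
    (hB.2.2 _ Finset.inter_subset_right hne hs))

theorem exists_mem_mapComponents (f : V → V) (v : V) : ∃ A ∈ mapComponents f, v ∈ A := by
  classical
  have hne : (Finset.univ.filter fun A : Finset V => v ∈ A ∧ Saturated f A).Nonempty :=
    ⟨Finset.univ, Finset.mem_filter.2 ⟨Finset.mem_univ _, by simp [Saturated]⟩⟩
  obtain ⟨A, hA, hmin⟩ := Finset.exists_min_image _ Finset.card hne
  simp only [Finset.mem_filter, Finset.mem_univ, true_and] at hA hmin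
  refine ⟨A, mem_mapComponents.2 ⟨⟨v, hA.1⟩, hA.2, fun B hBA hB hBs => ?_⟩, hA.1⟩
  by_cases hv : v ∈ B
  · exact Finset.eq_of_subset_of_card_le hBA (hmin B ⟨hv, hBs⟩)
  · have h1 := hmin (A \ B) ⟨Finset.mem_sdiff.2 ⟨hA.1, hv⟩, fun w => by
      rw [Finset.mem_sdiff, Finset.mem_sdiff, hA.2 w, hBs w]⟩
    have h2 := Finset.card_sdiff_add_card_eq_card hBA
    have h3 := hB.card_pos
    omega

theorem sum_compSizes (f : V → V) : (compSizes f).sum = Fintype.card V := by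
  classical
  have h : (mapComponents f).biUnion id = Finset.univ := by
    ext v
    simpa using exists_mem_mapComponents f v
  rw [compSizes, ← Finset.card_univ, ← h, Finset.card_biUnion]
  · rfl
  · exact fun A hA B hB hAB => disjoint_of_mem_mapComponents hA hB hAB

theorem univ_mem_mapComponents_iff {f : V → V} :
    Finset.univ ∈ mapComponents f ↔ compSizes f = {Fintype.card V} := by
  classical
  constructor
  · intro h
    have : mapComponents f = {Finset.univ} := by
      refine Finset.eq_singleton_iff_unique_mem.2 ⟨h, fun A hA => ?_⟩
      have hA' := mem_mapComponents.1 hA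
      exact (mem_mapComponents.1 h).2.2 A (Finset.subset_univ _) hA'.1 hA'.2.1
    rw [compSizes, this]
    simp
  · intro h
    obtain ⟨A, hA⟩ : ∃ A, A ∈ mapComponents f ∧ A.card = Fintype.card V := by
      have : Fintype.card V ∈ compSizes f := by rw [h]; simp
      simpa [compSizes] using this
    rw [← Finset.card_eq_iff_eq_univ A |>.1 hA.2]
    exact hA.1

theorem map_mem_mapComponents_relabel (e : V ≃ W) (f : V → V) (A : Finset V) :
    A.map e.toEmbedding ∈ mapComponents (relabel e f) ↔ A ∈ mapComponents f := by
  rw [mem_mapComponents, mem_mapComponents, Finset.map_nonempty, saturated_relabel]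
  refine and_congr_right fun _ => and_congr_right fun _ => ?_
  constructor
  · intro h B hB hne hs
    exact Finset.map_injective _ (h (B.map e.toEmbedding) (Finset.map_subset_map.2 hB)
      (by simpa using hne) ((saturated_relabel e f B).2 hs))
  · intro h B hB hne hs
    obtain ⟨B, rfl⟩ : ∃ B' : Finset V, B = B'.map e.toEmbedding :=
      ⟨B.map e.symm.toEmbedding, by ext; simp⟩
    rw [h B (Finset.map_subset_map.1 hB) (by simpa using hne) ((saturated_relabel e f B).1 hs)]

theorem mapComponents_relabel (e : V ≃ W) (f : V → V) : mapComponents (relabel e f) =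
    (mapComponents f).map (Finset.mapEmbedding e.toEmbedding).toEmbedding := by
  ext B
  obtain ⟨B, rfl⟩ : ∃ B' : Finset V, B = B'.map e.toEmbedding :=
    ⟨B.map e.symm.toEmbedding, by ext; simp⟩
  rw [map_mem_mapComponents_relabel, Finset.mem_map]
  constructor
  · exact fun h => ⟨B, h, rfl⟩
  · rintro ⟨A, hA, h⟩
    rwa [← Finset.map_injective _ h]

theorem compSizes_relabel (e : V ≃ W) (f : V → V) : compSizes (relabel e f) = compSizes f := by
  rw [compSizes, mapComponents_relabel, Finset.map_val, Multiset.map_map, compSizes]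
  refine Multiset.map_congr rfl fun A _ => ?_
  simp [Finset.mapEmbedding]

theorem map_inl_mem_mapComponents_sumMap {g : V → V} {h : W → W} {A : Finset V} :
    A.disjSum ∅ ∈ mapComponents (Sum.map g h) ↔ A ∈ mapComponents g := by
  have h0 : Saturated h ∅ := by simp [Saturated]
  rw [mem_mapComponents, mem_mapComponents, saturated_sumMap, Finset.disjSum_empty,
    Finset.map_nonempty, and_iff_left h0]
  refine and_congr_right fun _ => and_congr_right fun _ => ?_
  constructor
  · intro H B hB hne hs
    have := H (B.disjSum ∅) (by simpa using hB) (by simpa using hne)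
      (saturated_sumMap.2 ⟨hs, h0⟩)
    simpa using this
  · intro H B hB hne hs
    have hr : B.toRight = ∅ := by
      ext w
      simp only [Finset.mem_toRight, Finset.notMem_empty, iff_false]
      intro hw
      simpa using hB hw
    rw [eq_disjSum B, hr] at hB hne hs ⊢
    rw [H B.toLeft (by simpa using hB) (by simpa using hne) (saturated_sumMap.1 hs).1]
    simp

theorem map_inr_mem_mapComponents_sumMap {g : V → V} {h : W → W} {B : Finset W} :
    (∅ : Finset V).disjSum B ∈ mapComponents (Sum.map g h) ↔ B ∈ mapComponents h := by
  have h0 : Saturated g ∅ := by simp [Saturated]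
  rw [mem_mapComponents, mem_mapComponents, saturated_sumMap, Finset.empty_disjSum,
    Finset.map_nonempty, and_iff_right h0]
  refine and_congr_right fun _ => and_congr_right fun _ => ?_
  constructor
  · intro H A hA hne hs
    have := H ((∅ : Finset V).disjSum A) (by simpa using hA) (by simpa using hne)
      (saturated_sumMap.2 ⟨h0, hs⟩)
    simpa using this
  · intro H A hA hne hs
    have hr : A.toLeft = ∅ := by
      ext w
      simp only [Finset.mem_toLeft, Finset.notMem_empty, iff_false]
      intro hw
      simpa using hA hw
    rw [eq_disjSum A, hr] at hA hne hs ⊢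
    rw [H A.toRight (by simpa using hA) (by simpa using hne) (saturated_sumMap.1 hs).2]
    simp

theorem compSizes_sumMap (g : V → V) (h : W → W) :
    compSizes (Sum.map g h) = compSizes g + compSizes h := by
  classical
  have key : mapComponents (Sum.map g h) =
      (mapComponents g).image (fun A => A.disjSum (∅ : Finset W)) ∪
        (mapComponents h).image (fun B => (∅ : Finset V).disjSum B) := by
    ext C
    rw [Finset.mem_union, Finset.mem_image, Finset.mem_image]
    constructor
    · intro hC
      have hC' := mem_mapComponents.1 hC
      have hs := hC'.2.1
      rw [eq_disjSum C, saturated_sumMap] at hs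
      by_cases hl : C.toLeft.Nonempty
      · left
        have : C.toLeft.disjSum ∅ = C := by
          refine hC'.2.2 _ ?_ (by simpa using hl) (saturated_sumMap.2 ⟨hs.1, by simp [Saturated]⟩)
          intro x hx
          rcases x with x | x
          · simpa using hx
          · simp at hx
        rw [← this] at hC
        exact ⟨_, map_inl_mem_mapComponents_sumMap.1 hC, this⟩
      · right
        have : (∅ : Finset V).disjSum C.toRight = C := by
          rw [← Finset.not_nonempty_iff_eq_empty.1 hl]
          exact (eq_disjSum C).symm
        rw [← this] at hC
        exact ⟨_, map_inr_mem_mapComponents_sumMap.1 hC, this⟩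
    · rintro (⟨A, hA, rfl⟩ | ⟨B, hB, rfl⟩)
      · exact map_inl_mem_mapComponents_sumMap.2 hA
      · exact map_inr_mem_mapComponents_sumMap.2 hB
  have hd : Disjoint ((mapComponents g).image (fun A => A.disjSum (∅ : Finset W)))
      ((mapComponents h).image (fun B => (∅ : Finset V).disjSum B)) := by
    rw [Finset.disjoint_left]
    intro C hA hB
    obtain ⟨A, hAg, rfl⟩ := Finset.mem_image.1 hA
    obtain ⟨B, hBh, hAB⟩ := Finset.mem_image.1 hB
    obtain ⟨v, hv⟩ := (mem_mapComponents.1 hAg).1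
    have : Sum.inl v ∈ (∅ : Finset V).disjSum B := by rw [hAB]; simpa using hv
    simp at this
  rw [compSizes, key, ← Finset.disjUnion_eq_union _ _ hd, Finset.disjUnion_val, Multiset.map_add,
    Finset.image_val_of_injOn, Finset.image_val_of_injOn, Multiset.map_map, Multiset.map_map]
  · simp [compSizes]
  · intro A _ B _ hAB
    simpa using hAB
  · intro A _ B _ hAB
    simpa using hAB

/-! ### Total weights over all mappings -/

variable [DecidableEq V] [DecidableEq W]

/-- The weight `∏ j, ρ (ρ + 1) ⋯ (ρ + d j - 1)` of a mapping with in-degrees `d j`. The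
probability of a mapping under preferential attachment is proportional to its weight. -/
noncomputable def mapWeight {U : Type} [Fintype U] (ρ : ℝ) (f : U → V) : ℝ :=
  ∏ j : V, (ascPochhammer ℝ (Finset.univ.filter fun i => f i = j).card).eval ρ

theorem mapWeight_relabel (ρ : ℝ) (e : V ≃ W) (f : V → V) :
    mapWeight ρ (relabel e f) = mapWeight ρ f := by
  unfold mapWeight
  refine (Fintype.prod_equiv e _ _ fun j => ?_).symm
  congr 2
  refine Finset.card_equiv e fun i => ?_
  simp [relabel]

theorem mapWeight_sumMap (ρ : ℝ) (g : V → V) (h : W → W) :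
    mapWeight ρ (Sum.map g h) = mapWeight ρ g * mapWeight ρ h := by
  unfold mapWeight
  rw [Fintype.prod_sum_type]
  congr 1
  · refine Finset.prod_congr rfl fun j _ => ?_
    congr 2
    refine Eq.trans ?_ (Finset.card_map (Function.Embedding.inl (β := W)))
    congr 1
    ext (x | x) <;> simp
  · refine Finset.prod_congr rfl fun j _ => ?_
    congr 2
    refine Eq.trans ?_ (Finset.card_map (Function.Embedding.inr (α := V)))
    congr 1
    ext (x | x) <;> simp

/-- The sum of the weights of all mappings of `V`, each multiplied by the value of `φ` at its
component sizes. -/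
noncomputable def totalWeight (ρ : ℝ) (φ : Multiset ℕ → ℝ) (V : Type) [Fintype V] [DecidableEq V] : ℝ :=
  ∑ f : V → V, mapWeight ρ f * φ (compSizes f)

theorem totalWeight_congr (ρ : ℝ) (φ : Multiset ℕ → ℝ) (e : V ≃ W) :
    totalWeight ρ φ V = totalWeight ρ φ W := by
  unfold totalWeight
  refine Fintype.sum_equiv ⟨relabel e, relabel e.symm, relabel_symm_relabel e, fun f => ?_⟩ _ _
    fun f => ?_
  · simpa using relabel_symm_relabel e.symm f
  · simp [mapWeight_relabel, compSizes_relabel]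

theorem totalWeight_eq_fin (ρ : ℝ) (φ : Multiset ℕ → ℝ) {n : ℕ} (hn : Fintype.card V = n) :
    totalWeight ρ φ V = totalWeight ρ φ (Fin n) :=
  totalWeight_congr ρ φ (Fintype.equivFinOfCardEq hn)

/-- The total weight of the connected mappings of `n` points. -/
noncomputable def connectedWeight (ρ : ℝ) (n : ℕ) : ℝ :=
  totalWeight ρ (fun s => if s = {n} then 1 else 0) (Fin n)

/-- A mapping with the component `A` consists of a connected mapping of `A` and a mapping of the
complement of `A`. -/
theorem sum_of_mem_mapComponents (ρ : ℝ) (φ : Multiset ℕ → ℝ) (A : Finset V) :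
    ∑ f : V → V, (if A ∈ mapComponents f then
        mapWeight ρ f * φ ((compSizes f).erase A.card) else 0) =
      connectedWeight ρ A.card * totalWeight ρ φ (Fin (Fintype.card V - A.card)) := by
  set e : {v // v ∈ A} ⊕ {v // ¬ v ∈ A} ≃ V := Equiv.sumCompl (fun v => v ∈ A) with he
  have hA : A = (Finset.univ.disjSum ∅ : Finset ({v // v ∈ A} ⊕ {v // ¬ v ∈ A})).map
      e.toEmbedding := by
    ext v
    rw [Finset.mem_map_equiv]
    by_cases hv : v ∈ A
    · simp [he, hv]
    · simp [he, hv]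
  have hcard : Fintype.card {v // v ∈ A} = A.card := Fintype.card_coe A
  have hcard' : Fintype.card {v // ¬ v ∈ A} = Fintype.card V - A.card := by
    rw [Fintype.card_subtype_compl, hcard]
  have hmem : ∀ (g : {v // v ∈ A} → {v // v ∈ A}) (h : {v // ¬ v ∈ A} → {v // ¬ v ∈ A}),
      A ∈ mapComponents (relabel e (Sum.map g h)) ↔ compSizes g = {A.card} := by
    intro g h
    have := map_mem_mapComponents_relabel e (Sum.map g h) (Finset.univ.disjSum ∅)
    rw [← hA, map_inl_mem_mapComponents_sumMap, univ_mem_mapComponents_iff, hcard] at this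
    exact this
  have hinj : Function.Injective fun q : ({v // v ∈ A} → {v // v ∈ A}) ×
      ({v // ¬ v ∈ A} → {v // ¬ v ∈ A}) => relabel e (Sum.map q.1 q.2) := by
    rintro ⟨g, h⟩ ⟨g', h'⟩ hq
    have h1 := congrArg (relabel e.symm) hq
    simp only [relabel_symm_relabel] at h1
    refine Prod.ext (funext fun x => ?_) (funext fun x => ?_)
    · simpa using congrFun h1 (Sum.inl x)
    · simpa using congrFun h1 (Sum.inr x)
  rw [connectedWeight, ← totalWeight_eq_fin ρ _ hcard, ← totalWeight_eq_fin ρ _ hcard', totalWeight,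
    totalWeight, Finset.sum_mul_sum, ← Finset.sum_product', Finset.univ_product_univ]
  symm
  refine Finset.sum_of_injOn (fun q : ({v // v ∈ A} → {v // v ∈ A}) ×
      ({v // ¬ v ∈ A} → {v // ¬ v ∈ A}) => relabel e (Sum.map q.1 q.2)) (hinj.injOn)
    (fun _ _ => Finset.mem_coe.2 (Finset.mem_univ _)) (fun f _ hf => ?_) (fun q _ => ?_)
  · refine if_neg fun hAf => hf ?_
    have hsat : Saturated (relabel e.symm f) (Finset.univ.disjSum ∅) := by
      rw [← saturated_relabel e, ← hA]
      have := relabel_symm_relabel e.symm f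
      rw [Equiv.symm_symm] at this
      rw [this]
      exact (mem_mapComponents.1 hAf).2.1
    obtain ⟨g, h, hgh⟩ := exists_sumMap_eq hsat
    refine ⟨(g, h), by simp, ?_⟩
    have := relabel_symm_relabel e.symm f
    rw [Equiv.symm_symm, ← hgh] at this
    exact this
  · simp only [hmem, mapWeight_relabel, compSizes_relabel, mapWeight_sumMap, compSizes_sumMap]
    split_ifs with hq
    · rw [hq, Multiset.singleton_add, Multiset.erase_cons_head]
      ring
    · ring

theorem totalWeight_sum_erase (ρ : ℝ) (φ : Multiset ℕ → ℝ) (m : ℕ) (n : ℕ) :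
    totalWeight ρ (fun s => (s.map fun a : ℕ => (a : ℝ) ^ m * φ (s.erase a)).sum) (Fin n) =
      ∑ k ∈ Finset.range (n + 1), (n.choose k : ℝ) *
        ((k : ℝ) ^ m * (connectedWeight ρ k * totalWeight ρ φ (Fin (n - k)))) := by
  have h1 : totalWeight ρ (fun s => (s.map fun a : ℕ => (a : ℝ) ^ m * φ (s.erase a)).sum) (Fin n) =
      ∑ f : Fin n → Fin n, ∑ A : Finset (Fin n), (A.card : ℝ) ^ m *
        (if A ∈ mapComponents f then mapWeight ρ f * φ ((compSizes f).erase A.card) else 0) := by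
    unfold totalWeight
    refine Finset.sum_congr rfl fun f _ => ?_
    rw [← Finset.sum_subset (Finset.subset_univ (mapComponents f))
      (fun A _ hA => by rw [if_neg hA, mul_zero])]
    have h2 : ((compSizes f).map fun a : ℕ => (a : ℝ) ^ m * φ ((compSizes f).erase a)).sum =
        ∑ A ∈ mapComponents f, (A.card : ℝ) ^ m * φ ((compSizes f).erase A.card) := by
      conv_lhs => arg 1; arg 2; rw [compSizes]
      rw [Multiset.map_map]
      rfl
    refine (congrArg (mapWeight ρ f * ·) h2).trans ?_
    simp only [Finset.mul_sum]
    refine Finset.sum_congr rfl fun A hA => ?_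
    rw [if_pos hA]
    ring
  rw [h1, Finset.sum_comm]
  have h3 : ∀ A : Finset (Fin n), ∑ f : Fin n → Fin n, (A.card : ℝ) ^ m *
      (if A ∈ mapComponents f then mapWeight ρ f * φ ((compSizes f).erase A.card) else 0) =
      (A.card : ℝ) ^ m *
        (connectedWeight ρ A.card * totalWeight ρ φ (Fin (n - A.card))) := by
    intro A
    have h4 := sum_of_mem_mapComponents ρ φ A
    rw [Fintype.card_fin] at h4
    rw [← Finset.mul_sum, ← h4]
  rw [Finset.sum_congr rfl fun A _ => h3 A, ← Finset.powerset_univ,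
    Finset.sum_powerset_apply_card
      (fun k => (k : ℝ) ^ m * (connectedWeight ρ k * totalWeight ρ φ (Fin (n - k))))]
  simp [nsmul_eq_mul]

end mapping

/-- The exponential generating function of the total weights. -/
noncomputable def totalWeightSeries (ρ : ℝ) (φ : Multiset ℕ → ℝ) : PowerSeries ℝ :=
  PowerSeries.mk fun n => totalWeight ρ φ (Fin n) / n.factorial

/-- The exponential generating function of the weights of connected mappings, with the `m`-th power
of the size as a factor. -/
noncomputable def connectedSeries (ρ : ℝ) (m : ℕ) : PowerSeries ℝ :=
  PowerSeries.mk fun k => (k : ℝ) ^ m * connectedWeight ρ k / k.factorial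

theorem eulerOp_connectedSeries (ρ : ℝ) (m : ℕ) :
    eulerOp (connectedSeries ρ m) = connectedSeries ρ (m + 1) := by
  ext n
  rw [coeff_eulerOp, connectedSeries, connectedSeries, PowerSeries.coeff_mk, PowerSeries.coeff_mk]
  ring

theorem totalWeightSeries_sum_erase (ρ : ℝ) (φ : Multiset ℕ → ℝ) (m : ℕ) :
    totalWeightSeries ρ (fun s => (s.map fun a : ℕ => (a : ℝ) ^ m * φ (s.erase a)).sum) =
      connectedSeries ρ m * totalWeightSeries ρ φ := by
  ext n
  rw [PowerSeries.coeff_mul, totalWeightSeries, PowerSeries.coeff_mk, totalWeight_sum_erase,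
    Finset.sum_div]
  simp only [connectedSeries, totalWeightSeries, PowerSeries.coeff_mk]
  rw [Finset.Nat.sum_antidiagonal_eq_sum_range_succ (f := fun k j =>
    (k : ℝ) ^ m * connectedWeight ρ k / k.factorial * (totalWeight ρ φ (Fin j) / j.factorial))]
  refine Finset.sum_congr rfl fun k hk => ?_
  have hkn : k ≤ n := Nat.lt_succ_iff.1 (Finset.mem_range.1 hk)
  rw [Nat.cast_choose ℝ hkn]
  have h1 : (n.factorial : ℝ) ≠ 0 := by positivity
  have h2 : (k.factorial : ℝ) ≠ 0 := by positivity
  have h3 : ((n - k).factorial : ℝ) ≠ 0 := by positivity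
  field_simp

/-! ### The law of the mapping -/

section urn

variable {n : ℕ} {ρ : ℝ}

theorem card_filter_fin_succ {k : ℕ} (x : Fin (k + 1) → Fin n) (j : Fin n) :
    (Finset.univ.filter fun i => x i = j).card =
      (Finset.univ.filter fun i => Fin.init x i = j).card +
        if x (Fin.last k) = j then 1 else 0 := by
  rw [Finset.card_filter, Fin.sum_univ_castSucc, Finset.card_filter]
  rfl

theorem urnWeight_eq (ρ : ℝ) : ∀ (k : ℕ) (x : Fin k → Fin n) (j : Fin n),
    urnWeight ρ k x j = ρ + (Finset.univ.filter fun i => x i = j).card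
  | 0, x, j => by simp [urnWeight]
  | k + 1, x, j => by
    rw [urnWeight, card_filter_fin_succ]
    by_cases hj : x (Fin.last k) = j
    · subst hj
      rw [Function.update_self, urnWeight_eq ρ k, if_pos rfl]
      push_cast
      ring
    · rw [Function.update_of_ne (Ne.symm hj), urnWeight_eq ρ k, if_neg hj, add_zero]

theorem sum_urnWeight (ρ : ℝ) (k : ℕ) (x : Fin k → Fin n) :
    ∑ j, urnWeight ρ k x j = n * ρ + k := by
  have h : ∑ j, (Finset.univ.filter fun i => x i = j).card = k := by
    rw [← Finset.card_eq_sum_card_fiberwise (fun i _ => Finset.mem_coe.2 (Finset.mem_univ (x i)))]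
    simp
  simp only [urnWeight_eq, Finset.sum_add_distrib, ← Nat.cast_sum, h]
  simp

theorem mapWeight_fin_succ (ρ : ℝ) {k : ℕ} (x : Fin (k + 1) → Fin n) :
    mapWeight ρ x = mapWeight ρ (Fin.init x : Fin k → Fin n) *
      urnWeight ρ k (Fin.init x) (x (Fin.last k)) := by
  have h : ∀ j, (ascPochhammer ℝ (Finset.univ.filter fun i => x i = j).card).eval ρ =
      (ascPochhammer ℝ (Finset.univ.filter fun i => Fin.init x i = j).card).eval ρ *
        if x (Fin.last k) = j then urnWeight ρ k (Fin.init x) j else 1 := by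
    intro j
    rw [card_filter_fin_succ]
    split_ifs
    · rw [ascPochhammer_succ_eval, urnWeight_eq]
    · rw [add_zero, mul_one]
  rw [mapWeight, mapWeight, Finset.prod_congr rfl fun j _ => h j, Finset.prod_mul_distrib,
    Finset.prod_ite_eq]
  simp

theorem mapWeight_nonneg {U V : Type} [Fintype U] [Fintype V] [DecidableEq V] (hρ : 0 < ρ)
    (f : U → V) : 0 ≤ mapWeight ρ f :=
  Finset.prod_nonneg fun _ _ => (ascPochhammer_pos _ _ hρ).le

variable [NeZero n]

theorem urnChoice_apply (hρ : 0 < ρ) {k : ℕ} (x : Fin k → Fin n) (j : Fin n) :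
    urnChoice hρ x j = ENNReal.ofReal (urnWeight ρ k x j / (n * ρ + k)) := by
  have hn : (0 : ℝ) < n := Nat.cast_pos.2 (NeZero.pos n)
  rw [urnChoice, PMF.normalize_apply, tsum_fintype,
    ← ENNReal.ofReal_sum_of_nonneg fun i _ => (urnWeight_pos hρ k x i).le, sum_urnWeight,
    ENNReal.ofReal_div_of_pos (by positivity), div_eq_mul_inv]

/-- The choices of the urn scheme are distributed in proportion to the weights `mapWeight`. -/
theorem urnHistory_apply (hρ : 0 < ρ) : ∀ (k : ℕ) (x : Fin k → Fin n),
    urnHistory n hρ k x = ENNReal.ofReal (mapWeight ρ x / (ascPochhammer ℝ k).eval (n * ρ))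
  | 0, x => by
    rw [urnHistory, Subsingleton.elim x Fin.elim0]
    simp [mapWeight]
  | k + 1, x => by
    have hn : (0 : ℝ) < n := Nat.cast_pos.2 (NeZero.pos n)
    rw [urnHistory, PMF.bind_apply, tsum_eq_single (Fin.init x), PMF.map_apply,
      tsum_eq_single (x (Fin.last k)), if_pos (Fin.snoc_init_self x).symm, urnHistory_apply hρ k,
      urnChoice_apply, ← ENNReal.ofReal_mul, mapWeight_fin_succ, ascPochhammer_succ_eval,
      div_mul_div_comm]
    · exact div_nonneg (mapWeight_nonneg hρ _) (ascPochhammer_pos _ _ (by positivity)).le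
    · intro j hj
      refine if_neg fun h => hj ?_
      rw [h, Fin.snoc_last]
    · intro y hy
      rw [PMF.map_apply, ENNReal.tsum_eq_zero.2, mul_zero]
      intro j
      refine if_neg fun h => hy ?_
      rw [h, Fin.init_snoc]

theorem preferentialMapping_apply (hρ : 0 < ρ) (f : Fin n → Fin n) :
    (preferentialMapping n hρ f).toReal =
      mapWeight ρ f / (ascPochhammer ℝ n).eval (n * ρ) := by
  have hn : (0 : ℝ) < n := Nat.cast_pos.2 (NeZero.pos n)
  rw [preferentialMapping, urnHistory_apply, ENNReal.toReal_ofReal]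
  exact div_nonneg (mapWeight_nonneg hρ _) (ascPochhammer_pos _ _ (by positivity)).le

theorem sum_mapWeight (hρ : 0 < ρ) :
    ∑ f : Fin n → Fin n, mapWeight ρ f = (ascPochhammer ℝ n).eval (n * ρ) := by
  have hn : (0 : ℝ) < n := Nat.cast_pos.2 (NeZero.pos n)
  have h := (preferentialMapping n hρ).tsum_coe
  rw [tsum_fintype] at h
  have h1 := congrArg ENNReal.toReal h
  rw [ENNReal.toReal_sum fun f _ => PMF.apply_ne_top _ f] at h1
  simp only [preferentialMapping_apply, ← Finset.sum_div, ENNReal.toReal_one] at h1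
  rwa [div_eq_one_iff_eq (ascPochhammer_pos _ _ (by positivity)).ne'] at h1

end urn

/-! ### Moments of the component sizes -/

theorem totalWeightSeries_one {ρ : ℝ} (hρ : 0 < ρ) :
    totalWeightSeries ρ (fun _ => 1) = weightSeries ρ := by
  ext n
  rw [totalWeightSeries, weightSeries, PowerSeries.coeff_mk, PowerSeries.coeff_mk]
  congr 1
  cases n with
  | zero => simp [totalWeight, mapWeight]
  | succ n =>
    rw [← sum_mapWeight hρ]
    simp [totalWeight]

theorem weightSeries_ne_zero {ρ : ℝ} (hρ : 0 < ρ) : weightSeries ρ ≠ 0 := fun h => by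
  simpa [h] using coeff_weightSeries_pos hρ 0

/-- The polynomial in `weightSeries ρ` that represents `connectedSeries ρ (m + 1)`. -/
noncomputable def connectedPoly (ρ : ℝ) : ℕ → Polynomial ℝ
  | 0 => Polynomial.C ρ⁻¹ * ((Polynomial.X - 1) * (Polynomial.C (ρ + 1) * Polynomial.X - 1))
  | m + 1 => (connectedPoly ρ m).derivative * (Polynomial.X * connectedPoly ρ 0)

/-- A mapping of `n` points has component sizes that sum to `n`, so that the Euler operator acts on
the weight series as multiplication by `connectedSeries ρ 1`. -/
theorem connectedSeries_one {ρ : ℝ} (hρ : 0 < ρ) :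
    connectedSeries ρ 1 = Polynomial.aeval (weightSeries ρ) (connectedPoly ρ 0) := by
  have h1 : connectedSeries ρ 1 * weightSeries ρ = eulerOp (weightSeries ρ) := by
    rw [← totalWeightSeries_one hρ, ← totalWeightSeries_sum_erase]
    ext n
    rw [coeff_eulerOp, totalWeightSeries, totalWeightSeries, PowerSeries.coeff_mk,
      PowerSeries.coeff_mk, ← mul_div_assoc, totalWeight, totalWeight, Finset.mul_sum]
    congr 1
    refine Finset.sum_congr rfl fun f _ => ?_
    have h := sum_compSizes f
    rw [Fintype.card_fin] at h
    have h2 : ((compSizes f).map fun a : ℕ => (a : ℝ) ^ 1 * (1 : ℝ)).sum = (n : ℝ) := by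
      refine Eq.trans ?_ (congrArg (Nat.cast (R := ℝ)) h)
      simp
    rw [h2]
    ring
  refine mul_right_cancel₀ (weightSeries_ne_zero hρ) ?_
  rw [h1, eulerOp_weightSeries ρ hρ.ne', connectedPoly, mul_comm]
  simp [Polynomial.aeval_C]

theorem connectedSeries_succ {ρ : ℝ} (hρ : 0 < ρ) (m : ℕ) :
    connectedSeries ρ (m + 1) = Polynomial.aeval (weightSeries ρ) (connectedPoly ρ m) := by
  induction m with
  | zero => exact connectedSeries_one hρ
  | succ m ih =>
    rw [← eulerOp_connectedSeries, ih, Derivation.map_aeval, connectedPoly, map_mul, map_mul,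
      ← connectedSeries_one hρ, Polynomial.aeval_X]
    have : eulerOp (weightSeries ρ) = weightSeries ρ * connectedSeries ρ 1 := by
      rw [eulerOp_weightSeries ρ hρ.ne', connectedSeries_one hρ, connectedPoly]
      simp [Polynomial.aeval_C]
    rw [this, smul_eq_mul]

theorem connectedPoly_zero_coeff (ρ : ℝ) :
    (connectedPoly ρ 0).natDegree ≤ 2 ∧ (connectedPoly ρ 0).coeff 2 = (ρ + 1) / ρ := by
  have h : connectedPoly ρ 0 = Polynomial.C ((ρ + 1) / ρ) * Polynomial.X ^ 2 +
      Polynomial.C (-((ρ + 2) / ρ)) * Polynomial.X + Polynomial.C ρ⁻¹ := by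
    rw [connectedPoly]
    simp only [div_eq_mul_inv, map_add, map_mul, map_neg, map_one]
    have : (Polynomial.C 2 : Polynomial ℝ) = 2 := rfl
    rw [this]
    ring
  rw [h]
  exact ⟨Polynomial.natDegree_quadratic_le, by simp⟩

/-- Each application of the Euler operator raises the degree in the weight series by two. -/
theorem connectedPoly_coeff (ρ : ℝ) (m : ℕ) : (connectedPoly ρ m).natDegree ≤ 2 * (m + 1) ∧
    (connectedPoly ρ m).coeff (2 * (m + 1)) = ((ρ + 1) / ρ) ^ (m + 1) * (2 ^ m * m.factorial) := by
  induction m with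
  | zero => simpa using connectedPoly_zero_coeff ρ
  | succ m ih =>
    have h0 := connectedPoly_zero_coeff ρ
    have h1 : (connectedPoly ρ m).derivative.natDegree ≤ 2 * m + 1 :=
      (Polynomial.natDegree_derivative_le _).trans (by omega)
    have h2 : (Polynomial.X * connectedPoly ρ 0).natDegree ≤ 3 :=
      Polynomial.natDegree_mul_le_of_le Polynomial.natDegree_X_le h0.1
    rw [connectedPoly, show 2 * (m + 1 + 1) = 2 * m + 1 + 3 by ring]
    refine ⟨Polynomial.natDegree_mul_le_of_le h1 h2, ?_⟩
    rw [Polynomial.coeff_mul_add_eq_of_natDegree_le h1 h2, Polynomial.coeff_derivative,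
      Polynomial.coeff_X_mul, h0.2, show 2 * m + 1 + 1 = 2 * (m + 1) by ring, ih.2,
      Nat.factorial_succ]
    push_cast
    ring

/-- The polynomial in `weightSeries ρ` that generates the total weights with the monomial symmetric
function of the component sizes as a factor. -/
noncomputable def momentPoly (ρ : ℝ) : List ℕ → Polynomial ℝ
  | [] => Polynomial.X
  | m :: l => connectedPoly ρ (m - 1) * momentPoly ρ l

theorem totalWeightSeries_mono {ρ : ℝ} (hρ : 0 < ρ) : ∀ l : List ℕ, (∀ m ∈ l, 1 ≤ m) →
    totalWeightSeries ρ (fun s => mono (powerSum ℝ s) l) =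
      Polynomial.aeval (weightSeries ρ) (momentPoly ρ l)
  | [], _ => by
    simp only [mono_nil]
    rw [totalWeightSeries_one hρ, momentPoly, Polynomial.aeval_X]
  | m :: l, hl => by
    simp only [List.mem_cons, forall_eq_or_imp] at hl
    have h := totalWeightSeries_sum_erase ρ (fun s => mono (powerSum ℝ s) l) m
    simp only [sum_pow_mul_mono_erase] at h
    rw [h, totalWeightSeries_mono hρ l hl.2, momentPoly, map_mul, ← connectedSeries_succ hρ,
      Nat.sub_add_cancel hl.1]

theorem momentPoly_coeff (ρ : ℝ) : ∀ l : List ℕ, (∀ m ∈ l, 1 ≤ m) →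
    (momentPoly ρ l).natDegree ≤ 2 * l.sum + 1 ∧ (momentPoly ρ l).coeff (2 * l.sum + 1) =
      ((ρ + 1) / ρ) ^ l.sum * (l.map fun m => (2 : ℝ) ^ (m - 1) * (m - 1).factorial).prod
  | [], _ => by simp [momentPoly]
  | m :: l, hl => by
    simp only [List.mem_cons, forall_eq_or_imp] at hl
    have h1 := momentPoly_coeff ρ l hl.2
    have h2 := connectedPoly_coeff ρ (m - 1)
    rw [Nat.sub_add_cancel hl.1] at h2
    have e : 2 * (m :: l).sum + 1 = 2 * m + (2 * l.sum + 1) := by rw [List.sum_cons]; ring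
    rw [e, momentPoly]
    refine ⟨Polynomial.natDegree_mul_le_of_le h2.1 h1.1, ?_⟩
    rw [Polynomial.coeff_mul_add_eq_of_natDegree_le h2.1 h1.1, h1.2, h2.2, List.map_cons, List.prod_cons,
      List.sum_cons]
    ring

/-- The mixed moment `E ∑ x i₁ ^ l₁ * ⋯ * x iₖ ^ lₖ`, summed over tuples of distinct indices, of
the Poisson–Dirichlet distribution with parameter `θ`. -/
noncomputable def pdMoment (θ : ℝ) (l : List ℕ) : ℝ :=
  (l.map fun m => θ * (m - 1).factorial).prod / (ascPochhammer ℝ l.sum).eval θ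

theorem powerRatioLimit_eq {ρ : ℝ} (hρ : 0 < ρ) (M : ℕ) :
    ((ρ + 1) / ρ) ^ M * powerRatioLimit ρ M * (2 ^ M * (ascPochhammer ℝ M).eval (1 / 2)) = 1 := by
  induction M with
  | zero => simp [powerRatioLimit]
  | succ M ih =>
    have h1 : powerRatioLimit ρ (M + 1) =
        powerRatioLimit ρ M * (ρ / ((ρ + 1) * (2 * M + 1))) := Finset.prod_range_succ _ _
    have h2 : (ρ + 1) / ρ * (ρ / ((ρ + 1) * (2 * M + 1))) * (2 * (1 / 2 + (M : ℝ))) = 1 := by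
      field_simp
      ring
    rw [h1, ascPochhammer_succ_eval, pow_succ, pow_succ]
    linear_combination ((ρ + 1) / ρ * (ρ / ((ρ + 1) * (2 * M + 1))) * (2 * (1 / 2 + (M : ℝ)))) * ih
      + h2

theorem momentPoly_coeff_mul_powerRatioLimit {ρ : ℝ} (hρ : 0 < ρ) (l : List ℕ)
    (hl : ∀ m ∈ l, 1 ≤ m) :
    (momentPoly ρ l).coeff (2 * l.sum + 1) * powerRatioLimit ρ l.sum = pdMoment (1 / 2) l := by
  have h1 : (l.map fun m => (2 : ℝ) ^ (m - 1) * (m - 1).factorial).prod =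
      2 ^ l.sum * (l.map fun m => (1 / 2 : ℝ) * (m - 1).factorial).prod := by
    induction l with
    | nil => simp
    | cons m l ih =>
      simp only [List.mem_cons, forall_eq_or_imp] at hl
      obtain ⟨m, rfl⟩ := Nat.exists_eq_add_of_le' hl.1
      simp only [List.map_cons, List.prod_cons, List.sum_cons, ih hl.2, Nat.add_sub_cancel]
      ring
  have h2 := powerRatioLimit_eq hρ l.sum
  have h3 : (ascPochhammer ℝ l.sum).eval (1 / 2 : ℝ) ≠ 0 := (ascPochhammer_pos _ _ (by norm_num)).ne'
  rw [(momentPoly_coeff ρ l hl).2, h1, pdMoment, eq_div_iff h3]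
  linear_combination (l.map fun m => (1 / 2 : ℝ) * (m - 1).factorial).prod * h2

/-- The expected monomial symmetric functions of the component sizes, normalized by the total
weight and by `n ^ l.sum`, converge to the moments of the Poisson–Dirichlet distribution. -/
theorem tendsto_totalWeight_mono {ρ : ℝ} (hρ : 0 < ρ) (l : List ℕ) (hl : ∀ m ∈ l, 1 ≤ m) :
    Tendsto (fun n : ℕ => totalWeight ρ (fun s => mono (powerSum ℝ s) l) (Fin n) /
      ((ascPochhammer ℝ n).eval (n * ρ) * (n : ℝ) ^ l.sum)) atTop (𝓝 (pdMoment (1 / 2) l)) := by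
  have h := tendsto_coeff_aeval_weightSeries hρ l.sum (momentPoly ρ l) (momentPoly_coeff ρ l hl).1
  rw [momentPoly_coeff_mul_powerRatioLimit hρ l hl, ← totalWeightSeries_mono hρ l hl] at h
  refine h.congr fun n => ?_
  rw [totalWeightSeries, PowerSeries.coeff_mk, coeff_weightSeries]
  have : (n.factorial : ℝ) ≠ 0 := by positivity
  field_simp

/-! ### Power sums and ranking -/

section ranked

variable {ι : Type*} {x : ι → ℝ}

theorem inf'_le_ranked (h1 : ∀ s : Finset ι, ∑ i ∈ s, x i ≤ 1) {k : ℕ}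
    {s : Finset ι} (hs : s.card = k + 1) :
    s.inf' (Finset.card_pos.1 (by rw [hs]; exact Nat.succ_pos k)) x ≤ ranked x k := by
  refine le_ciSup (f := fun s : {s : Finset ι // s.card = k + 1} =>
    s.1.inf' (Finset.card_pos.1 (by rw [s.2]; exact Nat.succ_pos k)) x) ⟨1, ?_⟩ ⟨s, hs⟩
  rintro _ ⟨t, rfl⟩
  obtain ⟨i, hi⟩ := Finset.card_pos.1 (show 0 < t.1.card by rw [t.2]; exact Nat.succ_pos k)
  exact (Finset.inf'_le _ hi).trans (by simpa using h1 {i})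

theorem sum_pow_le_sum_ranked_pow (h0 : ∀ i, 0 ≤ x i) (h1 : ∀ s : Finset ι, ∑ i ∈ s, x i ≤ 1)
    (m N : ℕ) : ∀ s : Finset ι, s.card = N →
    ∑ i ∈ s, x i ^ m ≤ ∑ k ∈ Finset.range N, ranked x k ^ m := by
  classical
  induction N with
  | zero => intro s hs; simp [Finset.card_eq_zero.1 hs]
  | succ N ih =>
    intro s hs
    have hne : s.Nonempty := Finset.card_pos.1 (by omega)
    obtain ⟨i, hi, hmin⟩ := Finset.exists_mem_eq_inf' hne x
    have h2 : x i ≤ ranked x N := hmin ▸ inf'_le_ranked h1 hs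
    rw [← Finset.sum_erase_add _ _ hi, Finset.sum_range_succ]
    exact add_le_add (ih _ (by rw [Finset.card_erase_of_mem hi]; omega))
      (pow_le_pow_left₀ (h0 i) h2 m)

/-- A greedy choice of distinct indices attains the ranked values up to the factor `r < 1`. -/
theorem exists_sum_ranked_pow_le (h0 : ∀ i, 0 ≤ x i) (h1 : ∀ s : Finset ι, ∑ i ∈ s, x i ≤ 1)
    {r : ℝ} (hr0 : 0 ≤ r) (hr1 : r < 1) {m : ℕ} (hm : m ≠ 0) (N : ℕ) :
    ∃ t : Finset ι, t.card ≤ N ∧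
      ∑ k ∈ Finset.range N, (r * ranked x k) ^ m ≤ ∑ i ∈ t, x i ^ m := by
  classical
  have hmem := ranked_mem h0 h1
  induction N with
  | zero => exact ⟨∅, by simp⟩
  | succ N ih =>
    obtain ⟨t, htc, ht⟩ := ih
    rcases (hmem.1 N).eq_or_lt with h | h
    · refine ⟨t, by omega, ?_⟩
      rw [Finset.sum_range_succ, ← h, mul_zero, zero_pow hm, add_zero]
      exact ht
    · have hlt : r * ranked x N < ranked x N := mul_lt_of_lt_one_left h hr1
      have hne : Nonempty {s : Finset ι // s.card = N + 1} := by
        by_contra hne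
        have := not_nonempty_iff.1 hne
        have hz : ranked x N = 0 := Real.iSup_of_isEmpty _
        linarith
      obtain ⟨s, hs⟩ := exists_lt_of_lt_ciSup hlt
      obtain ⟨i, his, hit⟩ := Finset.exists_mem_notMem_of_card_lt_card
        (show t.card < s.1.card by rw [s.2]; omega)
      refine ⟨insert i t, (Finset.card_insert_le _ _).trans (by omega), ?_⟩
      have h2 := hs.trans_le (Finset.inf'_le x his)
      rw [Finset.sum_range_succ, Finset.sum_insert hit, add_comm]
      exact add_le_add (pow_le_pow_left₀ (by positivity) h2.le m) ht

theorem pow_le_self_of_sum_le (h0 : ∀ i, 0 ≤ x i) (h1 : ∀ s : Finset ι, ∑ i ∈ s, x i ≤ 1)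
    {m : ℕ} (hm : m ≠ 0) (i : ι) : x i ^ m ≤ x i :=
  pow_le_of_le_one (h0 i) (by simpa using h1 {i}) hm

theorem summable_pow_of_sum_le (h0 : ∀ i, 0 ≤ x i) (h1 : ∀ s : Finset ι, ∑ i ∈ s, x i ≤ 1)
    {m : ℕ} (hm : m ≠ 0) : Summable fun i => x i ^ m :=
  summable_of_sum_le (fun i => pow_nonneg (h0 i) m) fun s =>
    (Finset.sum_le_sum fun i _ => pow_le_self_of_sum_le h0 h1 hm i).trans (h1 s)

theorem sum_le_of_mem_rankedSimplex {x : ℕ → ℝ} (hx : x ∈ rankedSimplex) (s : Finset ℕ) :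
    ∑ i ∈ s, x i ≤ 1 :=
  (hx.2.2.1.sum_le_tsum s fun i _ => hx.1 i).trans hx.2.2.2

/-- Ranking does not change the power sums. -/
theorem tsum_ranked_pow (h0 : ∀ i, 0 ≤ x i) (h1 : ∀ s : Finset ι, ∑ i ∈ s, x i ≤ 1) {m : ℕ}
    (hm : m ≠ 0) : ∑' k, ranked x k ^ m = ∑' i, x i ^ m := by
  have hmem := ranked_mem h0 h1
  have hs := summable_pow_of_sum_le h0 h1 hm
  have hs' := summable_pow_of_sum_le hmem.1 (sum_le_of_mem_rankedSimplex hmem) hm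
  apply le_antisymm
  · refine Real.tsum_le_of_sum_range_le (fun k => pow_nonneg (hmem.1 k) m) fun N => ?_
    have hr : ∀ r : ℝ, 0 ≤ r → r < 1 →
        r ^ m * ∑ k ∈ Finset.range N, ranked x k ^ m ≤ ∑' i, x i ^ m := by
      intro r hr0 hr1
      obtain ⟨t, -, ht⟩ := exists_sum_ranked_pow_le h0 h1 hr0 hr1 hm N
      rw [Finset.mul_sum]
      simp only [mul_pow] at ht
      exact ht.trans (hs.sum_le_tsum t fun i _ => pow_nonneg (h0 i) m)
    have hlim : Tendsto (fun r : ℝ => r ^ m * ∑ k ∈ Finset.range N, ranked x k ^ m) (𝓝[<] 1)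
        (𝓝 (1 ^ m * ∑ k ∈ Finset.range N, ranked x k ^ m)) :=
      (((continuous_id.pow m).mul continuous_const).tendsto 1).mono_left nhdsWithin_le_nhds
    rw [one_pow, one_mul] at hlim
    refine le_of_tendsto hlim ?_
    filter_upwards [Ioo_mem_nhdsLT (show (0 : ℝ) < 1 by norm_num)] with r hr'
    exact hr r hr'.1.le hr'.2
  · refine hs.tsum_le_of_sum_le fun s => ?_
    exact (sum_pow_le_sum_ranked_pow h0 h1 m _ s rfl).trans
      (hs'.sum_le_tsum _ fun k _ => pow_nonneg (hmem.1 k) m)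

end ranked

/-! ### Polynomial test functions on the simplex -/

theorem le_one_div_of_mem_rankedSimplex {x : ℕ → ℝ} (hx : x ∈ rankedSimplex) (i : ℕ) :
    x i ≤ 1 / (i + 1) := by
  have hanti : Antitone x := antitone_nat_of_succ_le hx.2.1
  rw [le_div_iff₀ (by positivity)]
  have h : ∑ k ∈ Finset.range (i + 1), x i ≤ ∑ k ∈ Finset.range (i + 1), x k :=
    Finset.sum_le_sum fun k hk => hanti (Nat.lt_succ_iff.1 (Finset.mem_range.1 hk))
  rw [Finset.sum_const, Finset.card_range, nsmul_eq_mul] at h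
  push_cast at h
  linarith [sum_le_of_mem_rankedSimplex hx (Finset.range (i + 1))]

theorem isCompact_rankedSimplex : IsCompact rankedSimplex := by
  have heq : rankedSimplex = {x : ℕ → ℝ | (∀ i, 0 ≤ x i) ∧ (∀ i, x (i + 1) ≤ x i) ∧
      ∀ n, ∑ i ∈ Finset.range n, x i ≤ 1} := by
    ext x
    constructor
    · exact fun hx => ⟨hx.1, hx.2.1, fun n => sum_le_of_mem_rankedSimplex hx _⟩
    · exact fun hx => ⟨hx.1, hx.2.1, summable_of_sum_range_le hx.1 hx.2.2,
        Real.tsum_le_of_sum_range_le hx.1 hx.2.2⟩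
  have hclosed : IsClosed rankedSimplex := by
    rw [heq]
    simp only [Set.ofPred_and, Set.ofPred_forall]
    refine (isClosed_iInter fun i => isClosed_le continuous_const (continuous_apply i)).inter
      ((isClosed_iInter fun i => isClosed_le (continuous_apply (i + 1)) (continuous_apply i)).inter
        (isClosed_iInter fun n => isClosed_le ?_ continuous_const))
    exact continuous_finsetSum _ fun i _ => continuous_apply i
  refine (isCompact_univ_pi fun _ : ℕ => isCompact_Icc (a := (0 : ℝ)) (b := 1)).of_isClosed_subset
    hclosed fun x hx i _ => ⟨hx.1 i, ?_⟩
  simpa using sum_le_of_mem_rankedSimplex hx {i}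

instance : CompactSpace rankedSimplex := isCompact_iff_compactSpace.1 isCompact_rankedSimplex

/-- The power sum `∑ i, x i ^ m` is continuous on the simplex for `m ≥ 2`; for `m = 1` it is not. -/
theorem continuous_tsum_pow {m : ℕ} (hm : 2 ≤ m) :
    Continuous fun x : rankedSimplex => ∑' i, x.1 i ^ m := by
  refine continuous_tsum (u := fun i : ℕ => (1 / ((i : ℝ) + 1)) ^ 2)
    (fun i => ((continuous_apply i).comp continuous_subtype_val).pow m) ?_ fun i x => ?_
  · have h := (summable_nat_add_iff 1).2 (Real.summable_one_div_nat_pow.2 one_lt_two)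
    simpa [div_pow] using h
  · have h0 := x.2.1 i
    have h1 := le_one_div_of_mem_rankedSimplex x.2 i
    have h2 : x.1 i ≤ 1 := by simpa using sum_le_of_mem_rankedSimplex x.2 {i}
    rw [Real.norm_of_nonneg (pow_nonneg h0 m)]
    exact (pow_le_pow_of_le_one h0 h2 hm).trans (pow_le_pow_left₀ h0 h1 2)

/-- At the first index where two sequences with equal power sums differ, neither can be larger,
because high powers of the larger term would dominate. -/
theorem le_of_tsum_pow_eq {x y : ℕ → ℝ} (hx : x ∈ rankedSimplex) (hy : y ∈ rankedSimplex)
    (h : ∀ m, 2 ≤ m → ∑' i, x i ^ m = ∑' i, y i ^ m) {k : ℕ} (hk : ∀ i < k, x i = y i) :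
    x k ≤ y k := by
  by_contra! hlt
  have hy0 := hy.1 k
  have hx0 : 0 < x k := hy0.trans_lt hlt
  have hanti : Antitone y := antitone_nat_of_succ_le hy.2.1
  have hsx := fun {m : ℕ} (hm : m ≠ 0) =>
    summable_pow_of_sum_le hx.1 (sum_le_of_mem_rankedSimplex hx) hm
  have hsy := fun {m : ℕ} (hm : m ≠ 0) =>
    summable_pow_of_sum_le hy.1 (sum_le_of_mem_rankedSimplex hy) hm
  -- the tails of the power sums compare the `m`-th powers of `x k` and `y k` up to a constant
  have key : ∀ m : ℕ, x k ^ (m + 2) ≤ y k ^ m := by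
    intro m
    have h1 := h (m + 2) (by omega)
    rw [← (hsx (m := m + 2) (by omega)).sum_add_tsum_nat_add k,
      ← (hsy (m := m + 2) (by omega)).sum_add_tsum_nat_add k,
      Finset.sum_congr rfl fun i hi => by rw [hk i (Finset.mem_range.1 hi)], add_right_inj] at h1
    have h2 : x k ^ (m + 2) ≤ ∑' i, x (i + k) ^ (m + 2) := by
      have := ((summable_nat_add_iff k).2 (hsx (m := m + 2) (by omega))).le_tsum 0
        fun i _ => pow_nonneg (hx.1 _) _
      simpa using this
    refine h2.trans (h1.le.trans ?_)
    have hsy1 : Summable fun i => y (i + k) := (summable_nat_add_iff k).2 hy.2.2.1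
    have h3 : ∑' i, y (i + k) ^ (m + 2) ≤ ∑' i, y k ^ m * y (i + k) := by
      refine Summable.tsum_le_tsum (fun i => ?_)
        ((summable_nat_add_iff k).2 (hsy (m := m + 2) (by omega))) (hsy1.mul_left _)
      have h4 : y (i + k) ≤ y k := hanti (by omega)
      have h5 : y (i + k) ≤ 1 := by simpa using sum_le_of_mem_rankedSimplex hy {i + k}
      have h6 := hy.1 (i + k)
      rw [pow_add]
      exact mul_le_mul (pow_le_pow_left₀ h6 h4 m) (by nlinarith) (by positivity) (by positivity)
    refine h3.trans ?_
    rw [tsum_mul_left]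
    refine mul_le_of_le_one_right (by positivity) ?_
    refine Real.tsum_le_of_sum_range_le (fun i => hy.1 _) fun N => ?_
    rw [← Finset.sum_image (f := y) (g := fun i => i + k) (fun i _ j _ hij => by simpa using hij)]
    exact sum_le_of_mem_rankedSimplex hy _
  rcases hy0.eq_or_lt with h0 | h0
  · have := key 1
    rw [← h0] at this
    have : 0 < x k ^ (1 + 2) := by positivity
    simp at *
    linarith
  · obtain ⟨m, hm⟩ := pow_unbounded_of_one_lt (1 / x k ^ 2) ((one_lt_div h0).2 hlt)
    have := key m
    rw [div_pow, div_lt_div_iff₀ (by positivity) (by positivity), one_mul, ← pow_add] at hm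
    linarith

theorem eq_of_tsum_pow_eq {x y : ℕ → ℝ} (hx : x ∈ rankedSimplex) (hy : y ∈ rankedSimplex)
    (h : ∀ m, 2 ≤ m → ∑' i, x i ^ m = ∑' i, y i ^ m) : x = y := by
  funext k
  induction k using Nat.strong_induction_on with
  | _ k ih =>
    exact le_antisymm (le_of_tsum_pow_eq hx hy h ih)
      (le_of_tsum_pow_eq hy hx (fun m hm => (h m hm).symm) fun i hi => (ih i hi).symm)

theorem map_mono {R S : Type*} [CommRing R] [CommRing S] (φ : R →+* S) (p : ℕ → R) (l : List ℕ) :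
    φ (mono p l) = mono (fun m => φ (p m)) l := by
  induction l using mono_induction with
  | nil => simp [mono_nil]
  | cons m l ih =>
    rw [mono_cons, mono_cons, map_sub, map_mul, ih l le_rfl, map_list_sum, List.map_map]
    congr 2
    exact List.map_congr_left fun l' hl' => ih l' (length_of_mem_bumps hl').le

/-- The power sum as a continuous function on the simplex; for `m < 2` a dummy value. -/
noncomputable def simplexPowerSum (m : ℕ) : C(rankedSimplex, ℝ) :=
  if hm : 2 ≤ m then ⟨fun x => ∑' i, x.1 i ^ m, continuous_tsum_pow hm⟩ else 0

theorem simplexPowerSum_apply {m : ℕ} (hm : 2 ≤ m) (x : rankedSimplex) :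
    simplexPowerSum m x = ∑' i, x.1 i ^ m := by
  rw [simplexPowerSum, dif_pos hm]
  rfl

theorem mono_simplexPowerSum_apply {l : List ℕ} (hl : ∀ m ∈ l, 2 ≤ m) (x : rankedSimplex) :
    mono simplexPowerSum l x = mono (fun m => ∑' i, x.1 i ^ m) l := by
  have h := map_mono (ContinuousMap.evalAlgHom ℝ ℝ x).toRingHom simplexPowerSum l
  refine h.trans (mono_congr (r := 2) (fun m hm => ?_) l hl)
  exact simplexPowerSum_apply hm x

/-- The linear span of the monomial symmetric functions with exponents at least two. -/
noncomputable def monoSpan : Submodule ℝ C(rankedSimplex, ℝ) :=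
  Submodule.span ℝ {g | ∃ l : List ℕ, (∀ m ∈ l, 2 ≤ m) ∧ g = mono simplexPowerSum l}

theorem simplexPowerSum_mul_mem_monoSpan {m : ℕ} (hm : 2 ≤ m) {g : C(rankedSimplex, ℝ)}
    (hg : g ∈ monoSpan) : simplexPowerSum m * g ∈ monoSpan := by
  induction hg using Submodule.span_induction with
  | mem g hg =>
    obtain ⟨l, hl, rfl⟩ := hg
    have h := mono_cons simplexPowerSum m l
    rw [eq_sub_iff_add_eq] at h
    rw [← h]
    refine Submodule.add_mem _ (Submodule.subset_span ⟨m :: l, ?_, rfl⟩)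
      (list_sum_mem fun g hg => ?_)
    · simpa using ⟨hm, hl⟩
    · obtain ⟨l', hl', rfl⟩ := List.mem_map.1 hg
      exact Submodule.subset_span ⟨l', le_of_mem_bumps hl hl', rfl⟩
  | zero => rw [mul_zero]; exact Submodule.zero_mem _
  | add a b _ _ ha hb => rw [mul_add]; exact Submodule.add_mem _ ha hb
  | smul c a _ ha => rw [mul_smul_comm]; exact Submodule.smul_mem _ c ha

/-- The monomial symmetric functions span the algebra generated by the power sums, so that they
are dense by the Stone–Weierstrass theorem. -/
theorem dense_monoSpan : Dense (monoSpan : Set C(rankedSimplex, ℝ)) := by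
  set S : Set C(rankedSimplex, ℝ) := {g | ∃ m, 2 ≤ m ∧ g = simplexPowerSum m}
  have hle : ((Algebra.adjoin ℝ S : Subalgebra ℝ C(rankedSimplex, ℝ)) :
      Set C(rankedSimplex, ℝ)) ⊆ monoSpan := by
    have h : Subalgebra.toSubmodule (Algebra.adjoin ℝ S) ≤ monoSpan := by
      rw [Algebra.adjoin_eq_span, Submodule.span_le]
      intro g hg
      induction hg using Submonoid.closure_induction_left with
      | one => exact Submodule.subset_span ⟨[], by simp, (mono_nil _).symm⟩
      | mul_left s hs g _ ih =>
        obtain ⟨m, hm, rfl⟩ := hs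
        exact simplexPowerSum_mul_mem_monoSpan hm ih
    exact h
  have hsep : (Algebra.adjoin ℝ S).SeparatesPoints := by
    intro x y hxy
    by_contra! hcon
    refine hxy (Subtype.ext (eq_of_tsum_pow_eq x.2 y.2 fun m hm => ?_))
    rw [← simplexPowerSum_apply hm, ← simplexPowerSum_apply hm]
    exact hcon _ ⟨simplexPowerSum m, Algebra.subset_adjoin ⟨m, hm, rfl⟩, rfl⟩
  have h := ContinuousMap.subalgebra_topologicalClosure_eq_top_of_separatesPoints _ hsep
  refine Dense.mono hle ?_
  rw [dense_iff_closure_eq, ← Subalgebra.topologicalClosure_coe, h]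
  rfl

/-- Convergence of all mixed moments with exponents at least two implies weak convergence. -/
theorem tendsto_of_tendsto_integral_mono {μ : ℕ → ProbabilityMeasure rankedSimplex}
    {ν : ProbabilityMeasure rankedSimplex}
    (h : ∀ l : List ℕ, (∀ m ∈ l, 2 ≤ m) →
      Tendsto (fun n => ∫ x : rankedSimplex, mono (fun m => ∑' i, x.1 i ^ m) l ∂(μ n : Measure _))
        atTop (𝓝 (∫ x : rankedSimplex, mono (fun m => ∑' i, x.1 i ^ m) l ∂(ν : Measure _)))) :
    Tendsto μ atTop (𝓝 ν) := by
  have hint : ∀ (κ : ProbabilityMeasure rankedSimplex) (g : C(rankedSimplex, ℝ)),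
      Integrable g (κ : Measure rankedSimplex) := fun κ g =>
    (BoundedContinuousFunction.mkOfCompact g).integrable _
  have hspan : ∀ g ∈ monoSpan, Tendsto (fun n => ∫ x, g x ∂(μ n : Measure _)) atTop
      (𝓝 (∫ x, g x ∂(ν : Measure _))) := by
    intro g hg
    induction hg using Submodule.span_induction with
    | mem g hg =>
      obtain ⟨l, hl, rfl⟩ := hg
      simp only [mono_simplexPowerSum_apply hl]
      exact h l hl
    | zero => simp
    | add a b _ _ ha hb =>
      simp only [ContinuousMap.add_apply]
      rw [integral_add (hint _ a) (hint _ b)]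
      exact (ha.add hb).congr fun n => (integral_add (hint _ a) (hint _ b)).symm
    | smul c a _ ha =>
      simp only [ContinuousMap.smul_apply, smul_eq_mul, integral_const_mul]
      exact ha.const_mul c
  rw [ProbabilityMeasure.tendsto_iff_forall_integral_tendsto]
  intro f
  rw [Metric.tendsto_atTop]
  intro ε hε
  obtain ⟨g, hg, hfg⟩ := Metric.dense_iff.1 dense_monoSpan f.toContinuousMap (ε / 3) (by linarith)
  have hclose : ∀ κ : ProbabilityMeasure rankedSimplex,
      |∫ x, f x ∂(κ : Measure _) - ∫ x, g x ∂(κ : Measure _)| ≤ ε / 3 := by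
    intro κ
    rw [← integral_sub (f.integrable _) (hint κ g), ← Real.norm_eq_abs]
    refine (norm_integral_le_of_norm_le_const (C := ε / 3) (ae_of_all _ fun x => ?_)).trans_eq
      (by simp)
    rw [← dist_eq_norm, dist_comm]
    exact (ContinuousMap.dist_apply_le_dist (f := g) (g := f.toContinuousMap) x).trans
      (Metric.mem_ball.1 hg).le
  obtain ⟨N, hN⟩ := Metric.tendsto_atTop.1 (hspan g hfg) (ε / 3) (by linarith)
  refine ⟨N, fun n hn => ?_⟩
  have h1 := hN n hn
  have h2 := abs_le.1 (hclose (μ n))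
  have h3 := abs_le.1 (hclose ν)
  rw [Real.dist_eq, abs_lt] at h1 ⊢
  constructor <;> linarith [h1.1, h1.2, h2.1, h2.2, h3.1, h3.2]

/-! ### Moments of the Poisson–Dirichlet distribution -/

/-- The sequence with first term `z` and remaining terms `z'`. -/
def consSeq {α : Type*} (z : α) (z' : ℕ → α) : ℕ → α
  | 0 => z
  | k + 1 => z' k

theorem measurable_consSeq {α : Type*} [MeasurableSpace α] :
    Measurable fun q : α × (ℕ → α) => consSeq q.1 q.2 := by
  refine measurable_pi_lambda _ fun k => ?_
  cases k with
  | zero => exact measurable_fst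
  | succ k => exact (measurable_pi_apply k).comp measurable_snd

/-- Putting an independent term in front of an i.i.d. sequence gives an i.i.d. sequence. -/
theorem map_consSeq_prod {α : Type*} [MeasurableSpace α] (ν : Measure α) [IsProbabilityMeasure ν] :
    (ν.prod (Measure.infinitePi fun _ : ℕ => ν)).map (fun q => consSeq q.1 q.2) =
      Measure.infinitePi fun _ : ℕ => ν := by
  classical
  refine Measure.eq_infinitePi _ fun s t ht => ?_
  obtain ⟨N, hN⟩ := Finset.exists_nat_subset_range s
  set t' : ℕ → Set α := fun i => if i ∈ s then t i else Set.univ with ht'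
  have hmt' : ∀ i, MeasurableSet (t' i) := by
    intro i
    simp only [ht']
    split_ifs
    · exact ht i
    · exact MeasurableSet.univ
  have h1 : Set.pi (s : Set ℕ) t = Set.pi (Finset.range (N + 1) : Set ℕ) t' := by
    ext x
    simp only [Set.mem_pi, ht']
    constructor
    · intro h i _
      split_ifs with hi
      · exact h i (Finset.mem_coe.2 hi)
      · trivial
    · intro h i hi
      have h3 := Finset.mem_range.1 (hN (Finset.mem_coe.1 hi))
      have := h i (by simp; omega)
      rwa [if_pos (Finset.mem_coe.1 hi)] at this
  have h2 : ∏ i ∈ s, ν (t i) = ∏ i ∈ Finset.range (N + 1), ν (t' i) := by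
    rw [← Finset.prod_subset (hN.trans (Finset.range_subset_range.2 N.le_succ))]
    · exact Finset.prod_congr rfl fun i hi => by simp only [ht', if_pos hi]
    · intro i _ hi
      simp only [ht', if_neg hi, measure_univ]
  have h3 : (fun q : α × (ℕ → α) => consSeq q.1 q.2) ⁻¹' Set.pi (Finset.range (N + 1) : Set ℕ) t' =
      t' 0 ×ˢ Set.pi (Finset.range N : Set ℕ) fun i => t' (i + 1) := by
    ext ⟨z, z'⟩
    simp only [Set.mem_preimage, Set.mem_pi, Set.mem_prod, Finset.coe_range, Set.mem_Iio]
    constructor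
    · exact fun h => ⟨h 0 (by omega), fun i hi => h (i + 1) (by omega)⟩
    · rintro ⟨h0, h⟩ (_ | i) hi
      · exact h0
      · exact h i (by omega)
  rw [h1, h2, Measure.map_apply measurable_consSeq
    (MeasurableSet.pi (Set.to_countable _) fun i _ => hmt' i), h3, Measure.prod_prod,
    Measure.infinitePi_pi _ fun i _ => hmt' (i + 1), Finset.prod_range_succ', mul_comm]

theorem stick_consSeq_succ (z : unitInterval) (z' : ℕ → unitInterval) (k : ℕ) :
    stick (consSeq z z') (k + 1) = (1 - (z : ℝ)) * stick z' k := by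
  rw [stick, stick, Finset.prod_range_succ']
  simp only [consSeq]
  ring

/-- The stick after the first break is a rescaled copy of the whole stick. -/
theorem tsum_stick_consSeq_pow (z : unitInterval) (z' : ℕ → unitInterval) {m : ℕ} (hm : m ≠ 0) :
    ∑' k, stick (consSeq z z') k ^ m =
      (1 - (z : ℝ)) ^ m * ∑' k, stick z' k ^ m + (z : ℝ) ^ m := by
  rw [(summable_pow_of_sum_le (stick_nonneg _) (sum_stick_le _) hm).tsum_eq_zero_add, add_comm]
  congr 1
  · rw [← tsum_mul_left]
    exact tsum_congr fun k => by rw [stick_consSeq_succ, mul_pow]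
  · simp [stick, consSeq]

theorem mono_stick_consSeq (z : unitInterval) (z' : ℕ → unitInterval) {l : List ℕ}
    (hl : ∀ m ∈ l, 2 ≤ m) :
    mono (fun m => ∑' k, stick (consSeq z z') k ^ m) l =
      (1 - (z : ℝ)) ^ l.sum * mono (fun m => ∑' k, stick z' k ^ m) l +
        ((picks l).map fun q => (z : ℝ) ^ q.1 * (1 - (z : ℝ)) ^ q.2.sum *
          mono (fun m => ∑' k, stick z' k ^ m) q.2).sum := by
  rw [mono_congr (r := 2) (fun m hm => tsum_stick_consSeq_pow z z' (by omega)) l hl,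
    mono_add_pow (fun m => (1 - (z : ℝ)) ^ m * ∑' k, stick z' k ^ m), mono_pow_mul]
  simp only [mono_pow_mul, mul_assoc]

theorem betaPDFReal_nonneg {α β : ℝ} (hα : 0 < α) (hβ : 0 < β) (x : ℝ) :
    0 ≤ betaPDFReal α β x := by
  by_cases h : 0 < x ∧ x < 1
  · exact (betaPDFReal_pos h.1 h.2 hα hβ).le
  · simp [betaPDFReal, h]

theorem integral_betaPDFReal {α β : ℝ} (hα : 0 < α) (hβ : 0 < β) :
    ∫ x, betaPDFReal α β x = 1 := by
  rw [integral_eq_lintegral_of_nonneg_ae (ae_of_all _ (betaPDFReal_nonneg hα hβ))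
    (measurable_betaPDFReal α β).aestronglyMeasurable]
  have h := lintegral_betaPDF_eq_one hα hβ
  simp only [betaPDF] at h
  rw [h, ENNReal.toReal_one]

/-- The mixed moments of `z` and `1 - z` for a Beta`(1, θ)` distributed fraction `z`, which are
ratios of Beta functions. -/
theorem integral_stickFraction {θ : ℝ} (hθ : 0 < θ) (a b : ℕ) :
    ∫ z : unitInterval, (z : ℝ) ^ a * (1 - (z : ℝ)) ^ b ∂(stickFraction θ) =
      θ * a.factorial * (ascPochhammer ℝ b).eval θ / (ascPochhammer ℝ (a + b + 1)).eval θ := by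
  have hα : (0 : ℝ) < 1 + a := by positivity
  have hβ : (0 : ℝ) < θ + b := by positivity
  have h1 : ∀ x : ℝ, (betaPDF 1 θ x).toReal • (x ^ a * (1 - x) ^ b) =
      beta (1 + a) (θ + b) / beta 1 θ * betaPDFReal (1 + a) (θ + b) x := by
    intro x
    rw [betaPDF, ENNReal.toReal_ofReal (betaPDFReal_nonneg one_pos hθ x), smul_eq_mul]
    by_cases h : 0 < x ∧ x < 1
    · have hx : 0 < 1 - x := by linarith [h.2]
      have hb := beta_pos one_pos hθ
      have hb' := beta_pos hα hβ
      rw [betaPDFReal, betaPDFReal, if_pos h, if_pos h, sub_self, Real.rpow_zero, add_sub_cancel_left,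
        Real.rpow_natCast, show θ + b - 1 = θ - 1 + b by ring, Real.rpow_add hx, Real.rpow_natCast]
      field_simp
    · simp [betaPDFReal, h]
  have h2 : ∫ z : unitInterval, (z : ℝ) ^ a * (1 - (z : ℝ)) ^ b ∂(stickFraction θ) =
      beta (1 + a) (θ + b) / beta 1 θ := by
    rw [stickFraction, integral_subtype_comap measurableSet_Icc (fun x : ℝ => x ^ a * (1 - x) ^ b),
      betaMeasure, setIntegral_withDensity_eq_setIntegral_toReal_smul (f := betaPDF 1 θ)
        (measurable_betaPDFReal 1 θ).ennreal_ofReal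
        (ae_of_all _ fun x => ENNReal.ofReal_lt_top) _ measurableSet_Icc]
    simp only [h1]
    rw [integral_const_mul, setIntegral_eq_integral_of_forall_compl_eq_zero,
      integral_betaPDFReal hα hβ, mul_one]
    intro x hx
    exact if_neg fun h => hx ⟨h.1.le, h.2.le⟩
  have g1 := Gamma_add_nat hθ b
  have g2 := Gamma_add_nat hθ (a + b + 1)
  have g3 := Real.Gamma_pos_of_pos hθ
  have g4 := ascPochhammer_pos (a + b + 1) θ hθ
  rw [h2, beta, beta, show (1 : ℝ) + a + (θ + b) = θ + (a + b + 1 : ℕ) by push_cast; ring, g1, g2,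
    Real.Gamma_one, add_comm (1 : ℝ) θ, Real.Gamma_add_one hθ.ne', add_comm (1 : ℝ) a,
    Real.Gamma_nat_eq_factorial]
  field_simp

section

variable {θ : ℝ}

theorem mono_stick_eq {l : List ℕ} (hl : ∀ m ∈ l, 2 ≤ m) (z : ℕ → unitInterval) :
    mono (fun m => ∑' k, stick z k ^ m) l = mono simplexPowerSum l (rankedSticks z) := by
  rw [mono_simplexPowerSum_apply hl]
  exact mono_congr (r := 2)
    (fun m hm => (tsum_ranked_pow (stick_nonneg z) (sum_stick_le z) (by omega)).symm) l hl

theorem integrable_mono_stick {l : List ℕ} (hl : ∀ m ∈ l, 2 ≤ m)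
    (μ : Measure (ℕ → unitInterval)) [IsProbabilityMeasure μ] :
    Integrable (fun z => mono (fun m => ∑' k, stick z k ^ m) l) μ := by
  simp only [mono_stick_eq hl]
  obtain ⟨C, hC⟩ := (isCompact_range (mono simplexPowerSum l).continuous).isBounded.exists_norm_le
  exact Integrable.of_bound
    ((mono simplexPowerSum l).continuous.measurable.comp measurable_rankedSticks).aestronglyMeasurable
    C (ae_of_all _ fun z => hC _ ⟨_, rfl⟩)

theorem integrable_pow_stickFraction (hθ : 0 < θ) (a b : ℕ) :
    Integrable (fun z : unitInterval => (z : ℝ) ^ a * (1 - (z : ℝ)) ^ b) (stickFraction θ) := by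
  have := isProbabilityMeasure_stickFraction hθ
  refine Integrable.of_bound (Measurable.aestronglyMeasurable (by fun_prop)) 1
    (ae_of_all _ fun z => ?_)
  have h1 : 0 ≤ 1 - (z : ℝ) := sub_nonneg.2 z.2.2
  have h2 : 1 - (z : ℝ) ≤ 1 := by linarith [z.2.1]
  rw [Real.norm_of_nonneg (mul_nonneg (pow_nonneg z.2.1 a) (pow_nonneg h1 b))]
  exact mul_le_one₀ (pow_le_one₀ z.2.1 z.2.2) (pow_nonneg h1 b) (pow_le_one₀ h1 h2)

/-- The recursion for the mixed moments that results from the self-similarity of stick-breaking. -/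
theorem integral_mono_stick_recursion (hθ : 0 < θ) {l : List ℕ} (hl : ∀ m ∈ l, 2 ≤ m) :
    let μ := Measure.infinitePi fun _ : ℕ => stickFraction θ
    let e := fun l : List ℕ => ∫ z, mono (fun m => ∑' k, stick z k ^ m) l ∂μ
    e l = (∫ z : unitInterval, (z : ℝ) ^ 0 * (1 - (z : ℝ)) ^ l.sum ∂(stickFraction θ)) * e l +
      ((picks l).map fun q =>
        (∫ z : unitInterval, (z : ℝ) ^ q.1 * (1 - (z : ℝ)) ^ q.2.sum ∂(stickFraction θ)) *
          e q.2).sum := by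
  intro μ e
  have := isProbabilityMeasure_stickFraction hθ
  have hint : ∀ (a b : ℕ) (l' : List ℕ), (∀ m ∈ l', 2 ≤ m) →
      Integrable (fun q : unitInterval × (ℕ → unitInterval) => (q.1 : ℝ) ^ a *
        (1 - (q.1 : ℝ)) ^ b * mono (fun m => ∑' k, stick q.2 k ^ m) l')
        ((stickFraction θ).prod μ) := fun a b l' hl' =>
    (integrable_pow_stickFraction hθ a b).mul_prod (integrable_mono_stick hl' μ)
  have hval : ∀ (a b : ℕ) (l' : List ℕ),
      ∫ q : unitInterval × (ℕ → unitInterval), (q.1 : ℝ) ^ a *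
        (1 - (q.1 : ℝ)) ^ b * mono (fun m => ∑' k, stick q.2 k ^ m) l' ∂((stickFraction θ).prod μ) =
      (∫ z : unitInterval, (z : ℝ) ^ a * (1 - (z : ℝ)) ^ b ∂(stickFraction θ)) * e l' :=
    fun a b l' => integral_prod_mul (fun z : unitInterval => (z : ℝ) ^ a * (1 - (z : ℝ)) ^ b)
      fun z => mono (fun m => ∑' k, stick z k ^ m) l'
  have hpicks : ∀ L : List (ℕ × List ℕ), (∀ p ∈ L, ∀ m ∈ p.2, 2 ≤ m) →
      Integrable (fun q : unitInterval × (ℕ → unitInterval) => (L.map fun p => (q.1 : ℝ) ^ p.1 *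
        (1 - (q.1 : ℝ)) ^ p.2.sum * mono (fun m => ∑' k, stick q.2 k ^ m) p.2).sum)
        ((stickFraction θ).prod μ) ∧
      ∫ q : unitInterval × (ℕ → unitInterval), (L.map fun p => (q.1 : ℝ) ^ p.1 *
        (1 - (q.1 : ℝ)) ^ p.2.sum * mono (fun m => ∑' k, stick q.2 k ^ m) p.2).sum
        ∂((stickFraction θ).prod μ) = (L.map fun p =>
        (∫ z : unitInterval, (z : ℝ) ^ p.1 * (1 - (z : ℝ)) ^ p.2.sum ∂(stickFraction θ)) *
          e p.2).sum := by
    intro L hL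
    induction L with
    | nil => simp
    | cons p L ih =>
      simp only [List.mem_cons, forall_eq_or_imp] at hL
      have ih := ih hL.2
      simp only [List.map_cons, List.sum_cons]
      refine ⟨(hint _ _ _ hL.1).add ih.1, ?_⟩
      rw [integral_add (hint _ _ _ hL.1) ih.1, ih.2, hval]
  have hl' : ∀ p ∈ picks l, ∀ m ∈ p.2, 2 ≤ m := fun p hp m hm =>
    hl m ((perm_of_mem_picks hp).subset (List.mem_cons_of_mem _ hm))
  have hstart : e l = ∫ q : unitInterval × (ℕ → unitInterval),
      mono (fun m => ∑' k, stick (consSeq q.1 q.2) k ^ m) l ∂((stickFraction θ).prod μ) := by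
    have hmap := map_consSeq_prod (stickFraction θ)
    have h := integral_map (μ := (stickFraction θ).prod μ) measurable_consSeq.aemeasurable
      (f := fun z => mono (fun m => ∑' k, stick z k ^ m) l) (by
        rw [hmap]
        exact (integrable_mono_stick hl μ).aestronglyMeasurable)
    rw [hmap] at h
    exact h
  rw [← (hpicks _ hl').2, ← hval, ← integral_add (hint _ _ _ hl) (hpicks _ hl').1, hstart]
  refine integral_congr_ae (ae_of_all _ fun q => ?_)
  simp only [pow_zero, one_mul]
  exact mono_stick_consSeq q.1 q.2 hl

theorem integral_mono_stick (hθ : 0 < θ) (l : List ℕ) (hl : ∀ m ∈ l, 2 ≤ m) :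
    ∫ z, mono (fun m => ∑' k, stick z k ^ m) l
      ∂(Measure.infinitePi fun _ : ℕ => stickFraction θ) = pdMoment θ l := by
  have := isProbabilityMeasure_stickFraction hθ
  induction hn : l.length using Nat.strong_induction_on generalizing l with
  | _ n ih =>
    rcases eq_or_ne l [] with rfl | hne
    · simp [mono_nil, pdMoment]
    have hrec := integral_mono_stick_recursion hθ hl
    simp only at hrec
    set P := (l.map fun m => θ * ((m - 1).factorial : ℝ)).prod with hP
    set M := l.sum with hM
    have hA := ascPochhammer_pos M θ hθ
    have hA1 := ascPochhammer_succ_eval M θ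
    have hMpos : (0 : ℝ) < M := by
      obtain ⟨m, l', rfl⟩ := List.exists_cons_of_ne_nil hne
      have := hl m (by simp)
      rw [hM, List.sum_cons]
      exact_mod_cast (by omega)
    have hpick : ∀ q ∈ picks l,
        (∫ z : unitInterval, (z : ℝ) ^ q.1 * (1 - (z : ℝ)) ^ q.2.sum ∂(stickFraction θ)) *
          (∫ z, mono (fun m => ∑' k, stick z k ^ m) q.2
            ∂(Measure.infinitePi fun _ : ℕ => stickFraction θ)) =
        (q.1 : ℝ) * (P / (ascPochhammer ℝ (M + 1)).eval θ) := by
      intro q hq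
      have hperm := perm_of_mem_picks hq
      have hl2 : ∀ m ∈ q.2, 2 ≤ m := fun m hm => hl m (hperm.subset (List.mem_cons_of_mem _ hm))
      have hq1 : 2 ≤ q.1 := hl _ (hperm.subset (by simp))
      have hlen := length_of_mem_picks hq
      have hsum : q.1 + q.2.sum = M := by rw [hM, ← hperm.sum_eq, List.sum_cons]
      have hprod : P = θ * (q.1 - 1).factorial *
          (q.2.map fun m => θ * ((m - 1).factorial : ℝ)).prod := by
        rw [hP, ← (hperm.map _).prod_eq, List.map_cons, List.prod_cons]
      rw [ih q.2.length (by omega) q.2 hl2 rfl, integral_stickFraction hθ, hsum, pdMoment, hprod]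
      have h1 := ascPochhammer_pos q.2.sum θ hθ
      have h2 := ascPochhammer_pos (M + 1) θ hθ
      have h3 : (q.1.factorial : ℝ) = q.1 * (q.1 - 1).factorial := by
        exact_mod_cast (Nat.mul_factorial_pred (by omega)).symm
      rw [h3]
      field_simp
    have hs : ((picks l).map fun q => (q.1 : ℝ) *
        (P / (ascPochhammer ℝ (M + 1)).eval θ)).sum =
        M * (P / (ascPochhammer ℝ (M + 1)).eval θ) := by
      rw [List.sum_map_mul_right]
      congr 1
      rw [hM]
      conv_rhs => rw [← map_fst_picks l]
      rw [Nat.cast_list_sum, List.map_map]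
      rfl
    rw [List.map_congr_left hpick, hs, integral_stickFraction hθ, zero_add, hA1,
      Nat.factorial_zero] at hrec
    rw [pdMoment, ← hP, ← hM, eq_div_iff hA.ne']
    field_simp at hrec
    push_cast at hrec
    refine mul_left_cancel₀ hMpos.ne' ?_
    linear_combination hrec

end

/-! ### Convergence of the order statistics -/

theorem Saturated.mem_iff_of_reachable {n : ℕ} {f : Fin n → Fin n} {A : Finset (Fin n)}
    (hA : Saturated f A) {u v : Fin n}
    (h : (mappingDigraph f).toSimpleGraphInclusive.Reachable u v) : u ∈ A ↔ v ∈ A := by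
  obtain ⟨p⟩ := h
  induction p with
  | nil => rfl
  | cons hadj _ ih =>
    rw [← ih]
    rcases hadj.2 with h | h
    · rw [← hA, show f _ = _ from h]
    · rw [← show f _ = _ from h, hA]

theorem saturated_supp {n : ℕ} (f : Fin n → Fin n) (c : MappingComponent f) (A : Finset (Fin n))
    (hA : (A : Set (Fin n)) = c.supp) : Saturated f A := by
  intro v
  rw [← Finset.mem_coe, ← Finset.mem_coe, hA, SimpleGraph.ConnectedComponent.mem_supp_iff,
    SimpleGraph.ConnectedComponent.mem_supp_iff]
  by_cases hv : f v = v
  · rw [hv]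
  · have hadj : (mappingDigraph f).toSimpleGraphInclusive.Adj (f v) v := ⟨hv, Or.inr rfl⟩
    rw [SimpleGraph.ConnectedComponent.sound hadj.reachable]

/-- The connected components of the graph of a mapping are its minimal nonempty saturated sets. -/
theorem mem_mapComponents_iff_exists_supp {n : ℕ} (f : Fin n → Fin n) (A : Finset (Fin n)) :
    A ∈ mapComponents f ↔ ∃ c : MappingComponent f, (A : Set (Fin n)) = c.supp := by
  classical
  have hsub : ∀ (c : MappingComponent f) (B : Finset (Fin n)), Saturated f B →
      ∀ v ∈ B, v ∈ c.supp → c.supp ⊆ B := by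
    intro c B hB v hvB hvc w hw
    have : (mappingDigraph f).toSimpleGraphInclusive.Reachable v w :=
      SimpleGraph.ConnectedComponent.exact (hvc.trans hw.symm)
    exact (Saturated.mem_iff_of_reachable hB this).1 hvB
  rw [mem_mapComponents]
  constructor
  · rintro ⟨⟨v, hv⟩, hA, hmin⟩
    set c : MappingComponent f :=
      (mappingDigraph f).toSimpleGraphInclusive.connectedComponentMk v with hc
    have h1 : c.supp ⊆ A := hsub c A hA v hv rfl
    refine ⟨c, ?_⟩
    have h2 := hmin c.supp.toFinset (by simpa using h1) ⟨v, by simp [hc]⟩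
      (saturated_supp f c _ (by simp))
    rw [← h2]
    simp
  · rintro ⟨c, hc⟩
    refine ⟨?_, saturated_supp f c A hc, fun B hBA hne hB => ?_⟩
    · obtain ⟨v, hv⟩ := c.nonempty_supp
      exact ⟨v, by rwa [← hc] at hv⟩
    · obtain ⟨v, hv⟩ := hne
      have hvc : v ∈ c.supp := by rw [← hc]; exact hBA hv
      refine Finset.Subset.antisymm hBA fun w hw => ?_
      exact hsub c B hB v hv hvc (by rw [← hc]; exact hw)

theorem tsum_normalizedSize_pow {n : ℕ} (f : Fin n → Fin n) (m : ℕ) :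
    ∑' c : MappingComponent f, normalizedSize f c ^ m =
      ((n : ℝ)⁻¹) ^ m * powerSum ℝ (compSizes f) m := by
  classical
  have hfin : Fintype (MappingComponent f) := Fintype.ofFinite _
  rw [tsum_fintype, powerSum, compSizes, Multiset.map_map]
  change _ = _ * ∑ A ∈ mapComponents f, (A.card : ℝ) ^ m
  rw [Finset.mul_sum]
  refine Finset.sum_bij (fun c _ => c.supp.toFinset) (fun c _ => ?_) (fun c _ c' _ h => ?_)
    (fun A hA => ?_) (fun c _ => ?_)
  · exact (mem_mapComponents_iff_exists_supp f _).2 ⟨c, by simp⟩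
  · exact SimpleGraph.ConnectedComponent.supp_injective (by simpa using h)
  · obtain ⟨c, hc⟩ := (mem_mapComponents_iff_exists_supp f A).1 hA
    exact ⟨c, Finset.mem_univ _, by simp [← hc]⟩
  · rw [normalizedSize, Set.ncard_eq_toFinset_card', div_pow, inv_pow]
    ring

theorem mono_orderStatistics {n : ℕ} (f : Fin n → Fin n) {l : List ℕ} (hl : ∀ m ∈ l, 2 ≤ m) :
    mono (fun m => ∑' i, (orderStatistics f).1 i ^ m) l =
      mono (powerSum ℝ (compSizes f)) l / (n : ℝ) ^ l.sum := by
  have h : ∀ m, 2 ≤ m → ∑' i, (orderStatistics f).1 i ^ m =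
      ((n : ℝ)⁻¹) ^ m * powerSum ℝ (compSizes f) m := fun m hm =>
    (tsum_ranked_pow (fun c => by unfold normalizedSize; positivity)
      (sum_normalizedSize_le f) (by omega)).trans (tsum_normalizedSize_pow f m)
  rw [mono_congr h l hl, mono_pow_mul, inv_pow]
  ring

theorem integral_mono_orderStatisticsLaw (n : ℕ) [NeZero n] {ρ : ℝ} (hρ : 0 < ρ) {l : List ℕ}
    (hl : ∀ m ∈ l, 2 ≤ m) :
    ∫ x : rankedSimplex, mono (fun m => ∑' i, x.1 i ^ m) l ∂(orderStatisticsLaw n hρ : Measure _) =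
      totalWeight ρ (fun s => mono (powerSum ℝ s) l) (Fin n) /
        ((ascPochhammer ℝ n).eval (n * ρ) * (n : ℝ) ^ l.sum) := by
  change ∫ x : rankedSimplex, mono (fun m => ∑' i, x.1 i ^ m) l
    ∂((preferentialMapping n hρ).toMeasure.map orderStatistics) = _
  simp only [← mono_simplexPowerSum_apply hl]
  rw [integral_map Measurable.of_discrete.aemeasurable
    (mono simplexPowerSum l).continuous.aestronglyMeasurable, PMF.integral_eq_sum, totalWeight,
    Finset.sum_div]
  refine Finset.sum_congr rfl fun f _ => ?_
  rw [preferentialMapping_apply, mono_simplexPowerSum_apply hl, mono_orderStatistics f hl,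
    smul_eq_mul, div_mul_div_comm]

theorem integral_mono_poissonDirichlet {θ : ℝ} (hθ : 0 < θ) {l : List ℕ} (hl : ∀ m ∈ l, 2 ≤ m) :
    ∫ x : rankedSimplex, mono (fun m => ∑' i, x.1 i ^ m) l ∂(poissonDirichlet hθ : Measure _) =
      pdMoment θ l := by
  change ∫ x : rankedSimplex, mono (fun m => ∑' i, x.1 i ^ m) l
    ∂((Measure.infinitePi fun _ : ℕ => stickFraction θ).map rankedSticks) = _
  rw [← integral_mono_stick hθ l hl]
  simp only [← mono_simplexPowerSum_apply hl, mono_stick_eq hl]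
  exact integral_map measurable_rankedSticks.aemeasurable
    (mono simplexPowerSum l).continuous.aestronglyMeasurable

/-- As `n → ∞`, the joint distribution of the normalized order statistics of the component sizes
converges weakly, on the simplex `∇`, to the Poisson–Dirichlet distribution with parameter `1/2`.
The number of vertices is `n + 1` because there is no urn scheme without urns. -/
theorem theorem5 (ρ : ℝ) (hρ : 0 < ρ) :
    Tendsto (fun n : ℕ => orderStatisticsLaw (n + 1) hρ) atTop
      (𝓝 (poissonDirichlet (θ := 1 / 2) one_half_pos)) := by
  refine tendsto_of_tendsto_integral_mono fun l hl => ?_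
  simp only [integral_mono_orderStatisticsLaw _ hρ hl, integral_mono_poissonDirichlet _ hl]
  exact (tendsto_totalWeight_mono hρ l fun m hm => one_le_two.trans (hl m hm)).comp
    (tendsto_add_atTop_nat 1)
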